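/- Let $(\Omega,\mathcal F)$ be a measurable space with a measurable flow $(\theta_s)_{s\in\mathbb R^d}$, i.e. $(\omega,s)\mapsto\theta_s\omega$ is measurable, $\theta_0=\mathrm{id}$ and $\theta_s\circ\theta_t=\theta_{s+t}$, and let $\mathbb P$ be a probability measure on $\Omega$ that is invariant under every $\theta_s$. Let $\Phi,\Psi$ be stationary random measures on $\mathbb R^d$: measurable maps $\omega\mapsto\Phi_\omega,\Psi_\omega$ from $\Omega$ to the locally finite Borel measures on $\mathbb R^d$ with $\Phi_{\theta_s\omega}(B)=\Phi_\omega(B+s)$ and $\Psi_{\theta_s\omega}(B)=\Psi_\omega(B+s)$ for all $s$, $\omega$ and Borel sets $B$. Suppose that their intensities $\lambda_\Phi,\lambda_\Psi$, defined by $\mathbb E[\Phi(B)]=\lambda_\Phi\mathcal L_d(B)$ and $\mathbb E[\Psi(B)]=\lambda_\Psi\mathcal L_d(B)$ for all Borel sets $B$, where $\mathcal L_d$ is Lebesgue measure, are positive and finite. For locally finite Borel measures $\varphi,\psi$ on $\mathbb R^d$, a measurable function $f:\mathbb R^d\times\mathbb R^d\to[0,1]$ is a *constrained density* for $(\varphi,\psi)$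 if $\int f(x,\xi)\,\psi(d\xi)\le 1$ for all $x$ and $\int f(x,\xi)\,\varphi(dx)\le 1$ for all $\xi$. We say that $x_0$ *desires* $\xi_0$ if $f(x_0,\xi_0)<1$ and either $\int f(x_0,\xi)\,\psi(d\xi)\neq1$ or there is $\xi_1\in\mathbb R^d$ with $|x_0-\xi_1|>|x_0-\xi_0|$ and $f(x_0,\xi_1)>0$; and that $\xi_0$ *desires* $x_0$ if $f(x_0,\xi_0)<1$ and either $\int f(x,\xi_0)\,\varphi(dx)\neq1$ or there is $x_1\in\mathbb R^d$ with $|x_1-\xi_0|>|x_0-\xi_0|$ and $f(x_1,\xi_0)>0$. The density $f$ is *stable* if there is no $(x_0,\xi_0)\in\mathbb R^d\times\mathbb R^d$ such that $x_0$ desires $\xi_0$ and $\xi_0$ desires $x_0$. Suppose that for $\mathbb P$-almost every $\omega$ the pair $(\varphi,\psi)=(\Phi_\omega,\Psi_\omega)$ satisfies, with $S_r(x)$ the sphere of radius $r$ around $x$: - for $\varphi$-a.e. $x$ and every $r>0$ there is $s\in S_r(x)$ with $\psi(S_r(x)\setminus\{s\})=0$; - for $\psi$-a.e. $\xi$ and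 every $r>0$ there is $s\in S_r(\xi)$ with $\varphi(S_r(\xi)\setminus\{s\})=0$. Then for $\mathbb P$-almost every $\omega$, any two stable constrained densities for $(\Phi_\omega,\Psi_\omega)$ agree $(\Phi_\omega\otimes\Psi_\omega)$-almost everywhere. -/

import Mathlib

open MeasureTheory
open scoped NNReal ENNReal

namespace StableTransport

/-- `ℝ^d` with the Euclidean distance. -/
abbrev Space (d : ℕ) : Type := EuclideanSpace ℝ (Fin d)

section Random

variable {d : ℕ} {Ω : Type*} [MeasurableSpace Ω]

/-- `θ` is a measurable flow on `Ω`, indexed by `ℝ^d`. -/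
structure IsMeasurableFlow (θ : Space d → Ω → Ω) : Prop where
  measurable : Measurable fun p : Ω × Space d => θ p.2 p.1
  zero : ∀ ω, θ 0 ω = ω
  add : ∀ s t ω, θ s (θ t ω) = θ (s + t) ω

/-- The probability measure `P` is stationary: it is invariant under the flow. -/
def IsStationaryProb (θ : Space d → Ω → Ω) (P : Measure Ω) : Prop :=
  ∀ s, P.map (θ s) = P

/-- The natural flow on measures: `(shift s φ) B = φ (B + s)`. -/
noncomputable def shift (s : Space d) (φ : Measure (Space d)) : Measure (Space d) :=
  φ.map fun x => x - s

/-- `Φ` is a stationary random measure under `P`: `P` is a stationary measure, and `Φ` is a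
measurable and flow-adapted map into the locally finite measures. The σ-field on
`Measure (Space d)` is the one generated by the evaluations at Borel sets. -/
structure IsStationaryRandomMeasure (θ : Space d → Ω → Ω) (P : Measure Ω)
    (Φ : Ω → Measure (Space d)) : Prop where
  stationary : IsStationaryProb θ P
  locallyFinite : ∀ ω, IsLocallyFiniteMeasure (Φ ω)
  measurable : Measurable Φ
  flowAdapted : ∀ s ω, Φ (θ s ω) = shift s (Φ ω)

/-- `Φ` has intensity `c` under `P`: `E[Φ(B)] = c · Leb(B)` for every Borel set `B`. -/
def HasIntensity (P : Measure Ω) (Φ : Ω → Measure (Space d)) (c : ℝ≥0∞) : Prop :=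
  ∀ B : Set (Space d), MeasurableSet B → ∫⁻ ω, Φ ω B ∂P = c * volume B

end Random

section Deterministic

variable {d : ℕ}

/-- Sub-balancing density for `φ` (on sites `x`) and `ψ` (on centers `ξ`). -/
structure IsSubBalancing (φ ψ : Measure (Space d)) (f : Space d → Space d → ℝ≥0) : Prop where
  measurable : Measurable fun p : Space d × Space d => f p.1 p.2
  site_le : ∀ x, ∫⁻ ξ, (f x ξ : ℝ≥0∞) ∂ψ ≤ 1
  center_le : ∀ ξ, ∫⁻ x, (f x ξ : ℝ≥0∞) ∂φ ≤ 1

/-- Constrained density: sub-balancing and bounded by `1` everywhere. -/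
structure IsConstrained (φ ψ : Measure (Space d)) (f : Space d → Space d → ℝ≥0) : Prop
    extends IsSubBalancing φ ψ f where
  le_one : ∀ x ξ, f x ξ ≤ 1

/-- The site `x` is exhausted. -/
def Exhausted (ψ : Measure (Space d)) (f : Space d → Space d → ℝ≥0) (x : Space d) : Prop :=
  ∫⁻ ξ, (f x ξ : ℝ≥0∞) ∂ψ = 1

/-- The center `ξ` is sated. -/
def Sated (φ : Measure (Space d)) (f : Space d → Space d → ℝ≥0) (ξ : Space d) : Prop :=
  ∫⁻ x, (f x ξ : ℝ≥0∞) ∂φ = 1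

/-- The site `x₀` desires the center `ξ₀`. -/
def SiteDesires (ψ : Measure (Space d)) (f : Space d → Space d → ℝ≥0)
    (x₀ ξ₀ : Space d) : Prop :=
  f x₀ ξ₀ < 1 ∧ (¬ Exhausted ψ f x₀ ∨ ∃ ξ₁, dist x₀ ξ₀ < dist x₀ ξ₁ ∧ 0 < f x₀ ξ₁)

/-- The center `ξ₀` desires the site `x₀`. -/
def CenterDesires (φ : Measure (Space d)) (f : Space d → Space d → ℝ≥0)
    (x₀ ξ₀ : Space d) : Prop :=
  f x₀ ξ₀ < 1 ∧ (¬ Sated φ f ξ₀ ∨ ∃ x₁, dist x₀ ξ₀ < dist x₁ ξ₀ ∧ 0 < f x₁ ξ₀)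

/-- Stable constrained density: no `x₀` and `ξ₀` in `ℝ^d` desire each other. -/
structure IsStableConstrained (φ ψ : Measure (Space d)) (f : Space d → Space d → ℝ≥0) : Prop
    extends IsConstrained φ ψ f where
  stable : ∀ x₀ ξ₀, ¬ (SiteDesires ψ f x₀ ξ₀ ∧ CenterDesires φ f x₀ ξ₀)

/-- `μ` charges at most one point of every sphere of positive radius around `x`. -/
def SpheresOnePoint (μ : Measure (Space d)) (x : Space d) : Prop :=
  ∀ r : ℝ, 0 < r → ∃ s ∈ Metric.sphere x r, μ (Metric.sphere x r \ {s}) = 0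

/-- The uniqueness assumption on the pair `(φ, ψ)`. -/
def UniquenessAssumption (φ ψ : Measure (Space d)) : Prop :=
  (∀ᵐ x ∂φ, SpheresOnePoint ψ x) ∧ (∀ᵐ ξ ∂ψ, SpheresOnePoint φ ξ)

end Deterministic

end StableTransport

/-! The proof is a Gale–Shapley argument combined with mass transport.

In deferred acceptance with sites proposing, `avail`, the availability to the sites decreases from 1
and the availability to the centers increases from 0, because rejection is monotone in the offers
(`reject_mono`). A stable density `f` yields a pair (`siteOffer`, `centerOffer`) that is a fixed
point of one round up to null sets (`one_sub_reject_siteOffer`, `one_sub_reject_centerOffer`). Hence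
it is bounded by all iterates (`offer_le_avail`): the mass `f` sends from a site within distance `r`
is at most `siteMass`, and the mass a center receives within `r` is at least `centerMass`. With
centers proposing, the bounds are reversed.

Pathwise, `siteMass` dominates the `centerMass` of the exchanged procedure. The mass transport
principle, applied once to each procedure, gives the opposite inequality in expectation.
Expectations over a bounded set are finite, so almost surely the bounds coincide
(`ae_siteMass_le_centerMass`), and any two stable densities have the same masses in all balls around
almost every site and center.

It remains to recover the densities (`IsStableConstrained.ae_eq`). Where the ball of one endpoint,
reaching out to the other, has mass one, equal radial masses determine the density, since spheres
carry at most one point (`ae_eq_of_one_le_measure_closedBall`). Where both balls have mass below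
one, stability forces both densities to be 1 (`eq_one`). -/

namespace StableTransport

set_option linter.unusedSectionVars false

/-! ### Greedy acceptance by a single agent, nearest offers first -/

section OneVariable

open Metric Set Filter Topology

variable {E : Type*} [MetricSpace E] [MeasurableSpace E] [BorelSpace E]

theorem le_measure_closedBall_of_forall_gt {ν : Measure E} {x : E} {r : ℝ} {c : ℝ≥0∞}
    (hfin : ∀ r, ν (closedBall x r) < ∞) (h : ∀ ρ, r < ρ → c ≤ ν (closedBall x ρ)) :
    c ≤ ν (closedBall x r) := by
  have key := tendsto_measure_biInter_gt (μ := ν) (s := fun ρ => closedBall x ρ) (a := r)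
    (fun ρ _ => measurableSet_closedBall.nullMeasurableSet)
    (fun i j _ hij => closedBall_subset_closedBall hij) ⟨r + 1, by simp, (hfin _).ne⟩
  have hI : (⋂ ρ > r, closedBall x ρ) = closedBall x r := by
    ext y
    simp only [mem_iInter, mem_closedBall]
    exact ⟨fun hy => le_of_forall_gt_imp_ge_of_dense hy, fun hy ρ hρ => hy.trans hρ.le⟩
  rw [hI] at key
  refine ge_of_tendsto key ?_
  filter_upwards [self_mem_nhdsWithin] with ρ hρ using h ρ hρ

theorem measure_ball_le_of_forall_lt {ν : Measure E} {x : E} {r : ℝ} {c : ℝ≥0∞}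
    (h : ∀ ρ, ρ < r → ν (closedBall x ρ) ≤ c) : ν (ball x r) ≤ c := by
  obtain ⟨u, hu, hur, hlim⟩ := exists_seq_strictMono_tendsto r
  have hU : ball x r = ⋃ n, closedBall x (u n) := by
    ext y
    simp only [mem_ball, mem_iUnion, mem_closedBall]
    constructor
    · intro hy
      obtain ⟨n, hn⟩ := (hlim.eventually (lt_mem_nhds hy)).exists
      exact ⟨n, hn.le⟩
    · rintro ⟨n, hn⟩
      exact hn.trans_lt (hur n)
  have hmono : Monotone fun n => closedBall x (u n) :=
    fun i j hij => closedBall_subset_closedBall (hu.monotone hij)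
  rw [hU, hmono.measure_iUnion]
  exact iSup_le fun n => h _ (hur n)

theorem measure_ball_add_measure_sphere (ν : Measure E) (x : E) (r : ℝ) :
    ν (ball x r) + ν (sphere x r) = ν (closedBall x r) := by
  rw [← ball_union_sphere, measure_union sphere_disjoint_ball.symm isClosed_sphere.measurableSet]

/-- The proportion accepted at distance `r` from `x` when the offers `ν` are accepted in the order
of their distance to `x`, up to a total mass of one. -/
noncomputable def share (ν : Measure E) (x : E) (r : ℝ) : ℝ≥0∞ :=
  open Classical in
  if ν (closedBall x r) ≤ 1 then 1 else (1 - ν (ball x r)) / ν (sphere x r)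

theorem share_of_le {ν : Measure E} {x : E} {r : ℝ} (h : ν (closedBall x r) ≤ 1) :
    share ν x r = 1 := if_pos h

theorem share_of_lt {ν : Measure E} {x : E} {r : ℝ} (h : 1 < ν (closedBall x r)) :
    share ν x r = (1 - ν (ball x r)) / ν (sphere x r) := if_neg h.not_ge

theorem share_le_one (ν : Measure E) (x : E) (r : ℝ) : share ν x r ≤ 1 := by
  rcases le_or_gt (ν (closedBall x r)) 1 with h | h
  · rw [share_of_le h]
  · rw [share_of_lt h]
    refine ENNReal.div_le_of_le_mul ?_
    rw [one_mul, tsub_le_iff_left, measure_ball_add_measure_sphere]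
    exact h.le

/-- Additional offers use up capacity in the ball and dilute the sphere: the numerator shrinks and
the denominator grows. All monotonicity of the procedure rests on this. -/
theorem share_anti {ν ν' : Measure E} (h : ν ≤ ν') (x : E) (r : ℝ) :
    share ν' x r ≤ share ν x r := by
  rcases le_or_gt (ν (closedBall x r)) 1 with h1 | h1
  · rw [share_of_le h1]
    exact share_le_one _ _ _
  · rw [share_of_lt h1, share_of_lt (h1.trans_le (h _))]
    exact ENNReal.div_le_div (tsub_le_tsub_left (h _) _) (h _)

/-- The accepted part of the offers `w`. -/
noncomputable def accept (μ : Measure E) (x : E) (w : E → ℝ≥0∞) (y : E) : ℝ≥0∞ :=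
  w y * share (μ.withDensity w) x (dist y x)

/-- The rejected part of the offers `w`. -/
noncomputable def reject (μ : Measure E) (x : E) (w : E → ℝ≥0∞) (y : E) : ℝ≥0∞ :=
  w y * (1 - share (μ.withDensity w) x (dist y x))

theorem accept_add_reject (μ : Measure E) (x : E) (w : E → ℝ≥0∞) (y : E) :
    accept μ x w y + reject μ x w y = w y := by
  rw [accept, reject, ← mul_add, add_tsub_cancel_of_le (share_le_one _ _ _), mul_one]

theorem reject_le (μ : Measure E) (x : E) (w : E → ℝ≥0∞) (y : E) : reject μ x w y ≤ w y :=
  le_add_self.trans_eq (accept_add_reject μ x w y)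

/-- An almost everywhere comparison suffices away from `y`, because the other offers enter only
through `μ.withDensity w`; at `y` itself the comparison must hold pointwise. -/
theorem reject_mono {μ : Measure E} {x : E} {w w' : E → ℝ≥0∞} (h : w ≤ᵐ[μ] w') {y : E}
    (hy : w y ≤ w' y) : reject μ x w y ≤ reject μ x w' y :=
  mul_le_mul' hy (tsub_le_tsub_left (share_anti (withDensity_mono h) _ _) _)

theorem setLIntegral_accept_of_share_eq {μ : Measure E} {x : E} {w : E → ℝ≥0∞} (hw : Measurable w)
    {A : Set E} (hA : MeasurableSet A) {c : ℝ≥0∞}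
    (h : ∀ y ∈ A, share (μ.withDensity w) x (dist y x) = c) :
    ∫⁻ y in A, accept μ x w y ∂μ = μ.withDensity w A * c := by
  rw [withDensity_apply _ hA, ← lintegral_mul_const _ hw]
  exact setLIntegral_congr_fun hA fun y hy => by rw [accept, h y hy]

/-- The accepted mass within distance `r` is the offered mass, truncated at one. -/
theorem setLIntegral_closedBall_accept {μ : Measure E} {x : E} {w : E → ℝ≥0∞} (hw : Measurable w)
    (hfin : ∀ r, μ.withDensity w (closedBall x r) < ∞) (r : ℝ) :
    ∫⁻ y in closedBall x r, accept μ x w y ∂μ = min 1 (∫⁻ y in closedBall x r, w y ∂μ) := by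
  rw [← withDensity_apply w measurableSet_closedBall]
  set ν := μ.withDensity w with hν
  have hmono : ∀ a b, a ≤ b → ν (closedBall x a) ≤ ν (closedBall x b) :=
    fun a b hab => measure_mono (closedBall_subset_closedBall hab)
  rcases le_or_gt (ν (closedBall x r)) 1 with h | h
  · rw [min_eq_right h, setLIntegral_accept_of_share_eq hw measurableSet_closedBall (c := 1), mul_one]
    exact fun y hy => share_of_le ((hmono _ _ hy).trans h)
  rw [min_eq_left h.le]
  -- The infimum `r₀` is the critical radius: the share is 1 inside it, constant on its sphere and 0
  -- beyond.
  set S : Set ℝ := {ρ | 1 < ν (closedBall x ρ)} with hS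
  have hbdd : BddBelow S := by
    refine ⟨0, fun ρ hρ => ?_⟩
    by_contra hneg
    rw [hS, mem_ofPred_eq, closedBall_eq_empty.2 (not_le.1 hneg), measure_empty] at hρ
    exact absurd hρ (by simp)
  set r₀ := sInf S with hr₀
  have hr : r₀ ≤ r := csInf_le hbdd h
  have hgt : ∀ ρ, r₀ < ρ → 1 < ν (closedBall x ρ) := by
    intro ρ hρ
    obtain ⟨a, ha, haρ⟩ := exists_lt_of_csInf_lt ⟨r, h⟩ hρ
    exact lt_of_lt_of_le ha (hmono _ _ haρ.le)
  have hlt : ∀ ρ, ρ < r₀ → ν (closedBall x ρ) ≤ 1 :=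
    fun ρ hρ => not_lt.1 fun hc => hρ.not_ge (csInf_le hbdd hc)
  have hball : ν (ball x r₀) ≤ 1 := measure_ball_le_of_forall_lt hlt
  have hcb : 1 ≤ ν (closedBall x r₀) :=
    le_measure_closedBall_of_forall_gt hfin fun ρ hρ => (hgt ρ hρ).le
  have hdecomp : closedBall x r = closedBall x r₀ ∪ (closedBall x r \ closedBall x r₀) :=
    (union_sdiff_cancel (closedBall_subset_closedBall hr)).symm
  rw [hdecomp, lintegral_union (measurableSet_closedBall.diff measurableSet_closedBall)
      disjoint_sdiff_right, ← ball_union_sphere, lintegral_union isClosed_sphere.measurableSet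
      sphere_disjoint_ball.symm, ball_union_sphere,
    setLIntegral_accept_of_share_eq hw measurableSet_ball (c := 1)
      (fun y hy => share_of_le (hlt _ hy)),
    setLIntegral_accept_of_share_eq hw isClosed_sphere.measurableSet (c := share ν x r₀)
      (fun y hy => by rw [mem_sphere.1 hy]),
    setLIntegral_accept_of_share_eq hw (measurableSet_closedBall.diff measurableSet_closedBall)
      (c := 0), mul_zero, add_zero, mul_one, ← hν]
  -- The infimum need not belong to `S`: the closed ball may have mass exactly one, and then the
  -- critical sphere is accepted in full.
  · rcases le_or_gt (ν (closedBall x r₀)) 1 with h1 | h1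
    · rw [share_of_le h1, mul_one, measure_ball_add_measure_sphere]
      exact le_antisymm h1 hcb
    · have hsum := measure_ball_add_measure_sphere ν x r₀
      have hs0 : ν (sphere x r₀) ≠ 0 := by
        intro h0
        rw [h0, add_zero] at hsum
        exact absurd (hsum ▸ h1) hball.not_gt
      have hst : ν (sphere x r₀) ≠ ∞ :=
        ((measure_mono sphere_subset_closedBall).trans_lt (hfin r₀)).ne
      rw [share_of_lt h1, ENNReal.mul_div_cancel hs0 hst, add_tsub_cancel_of_le hball]
  · rintro y ⟨-, hy⟩
    have hy' : r₀ < dist y x := not_le.1 hy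
    -- Truncated subtraction makes the numerator 0, and the quotient is then 0 even if the sphere
    -- has no mass.
    rw [← hν, share_of_lt (hgt _ hy'), tsub_eq_zero_of_le, ENNReal.zero_div]
    exact hcb.trans (measure_mono (closedBall_subset_ball hy'))

theorem measure_ball_eq_of_closedBall_eq {ν₁ ν₂ : Measure E} {x : E}
    (h : ∀ r, ν₁ (closedBall x r) = ν₂ (closedBall x r)) (r : ℝ) :
    ν₁ (ball x r) = ν₂ (ball x r) :=
  le_antisymm
    (measure_ball_le_of_forall_lt fun ρ hρ =>
      (h ρ).trans_le (measure_mono (closedBall_subset_ball hρ)))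
    (measure_ball_le_of_forall_lt fun ρ hρ =>
      (h ρ).symm.trans_le (measure_mono (closedBall_subset_ball hρ)))

theorem measure_univ_le_of_closedBall_le {ν : Measure E} {x : E} {c : ℝ≥0∞}
    (h : ∀ r, ν (closedBall x r) ≤ c) : ν univ ≤ c := by
  have hmono : Monotone fun n : ℕ => closedBall x (n : ℝ) :=
    fun i j hij => closedBall_subset_closedBall (by exact_mod_cast hij)
  rw [← iUnion_closedBall_nat x, hmono.measure_iUnion]
  exact iSup_le fun n => h _

theorem ae_eq_zero_of_not_mem_closedBall {μ : Measure E} {x : E} {f : E → ℝ≥0∞}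
    (hf : Measurable f) (htot : μ.withDensity f univ ≤ 1) {r : ℝ}
    (h : 1 ≤ μ.withDensity f (closedBall x r)) :
    ∀ᵐ y ∂μ, y ∉ closedBall x r → f y = 0 := by
  have h0 : μ.withDensity f (closedBall x r)ᶜ = 0 := by
    have hle := (measure_mono (subset_univ (closedBall x r))).trans htot
    rw [measure_compl measurableSet_closedBall (hle.trans_lt ENNReal.one_lt_top).ne]
    exact tsub_eq_zero_of_le (htot.trans h)
  rw [withDensity_apply _ measurableSet_closedBall.compl,
    lintegral_eq_zero_iff hf, Filter.EventuallyEq,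
    ae_restrict_iff' measurableSet_closedBall.compl] at h0
  exact h0

/-- Two densities with the same masses in all balls around `x` agree almost everywhere beyond the
radius at which the mass reaches one, if no sphere around `x` charges more than one point. -/
theorem ae_eq_of_one_le_measure_closedBall {μ : Measure E} {x : E} {f g : E → ℝ≥0∞}
    (hf : Measurable f) (hg : Measurable g)
    (hone : ∀ r : ℝ, 0 < r → ∃ s ∈ sphere x r, μ (sphere x r \ {s}) = 0)
    (hatom : ∀ s, μ {s} < ∞)
    (h1 : ∀ r, ∫⁻ y in closedBall x r, f y ∂μ ≤ 1)
    (heq : ∀ r, ∫⁻ y in closedBall x r, f y ∂μ = ∫⁻ y in closedBall x r, g y ∂μ) :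
    ∀ᵐ y ∂μ, 1 ≤ ∫⁻ z in closedBall x (dist y x), f z ∂μ → f y = g y := by
  simp only [← withDensity_apply f measurableSet_closedBall,
    ← withDensity_apply g measurableSet_closedBall] at *
  set ν := μ.withDensity f with hν
  set ν' := μ.withDensity g with hν'
  set S : Set ℝ := {ρ | 1 ≤ ν (closedBall x ρ)} with hS
  have hmono : ∀ a b, a ≤ b → ν (closedBall x a) ≤ ν (closedBall x b) :=
    fun a b hab => measure_mono (closedBall_subset_closedBall hab)
  rcases S.eq_empty_or_nonempty with hemp | hne
  · refine .of_forall fun y hy => absurd (show dist y x ∈ S from hy) ?_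
    simp [hemp]
  have hpos : ∀ ρ ∈ S, 0 ≤ ρ := by
    intro ρ hρ
    by_contra hneg
    rw [hS, mem_ofPred_eq, closedBall_eq_empty.2 (not_le.1 hneg), measure_empty] at hρ
    exact absurd hρ (by simp)
  set r₀ := sInf S with hr₀
  have hr₀0 : 0 ≤ r₀ := le_csInf hne hpos
  have hcb : 1 ≤ ν (closedBall x r₀) := by
    refine le_measure_closedBall_of_forall_gt (fun r => (h1 r).trans_lt ENNReal.one_lt_top)
      fun ρ hρ => ?_
    obtain ⟨a, ha, haρ⟩ := exists_lt_of_csInf_lt hne hρ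
    exact le_trans ha (hmono _ _ haρ.le)
  have hlt : ∀ ρ, ρ < r₀ → ¬ 1 ≤ ν (closedBall x ρ) :=
    fun ρ hρ hc => hρ.not_ge (csInf_le ⟨0, hpos⟩ hc)
  -- The assumption concerns positive radii only; for `r₀ = 0` the sphere is the point `x`.
  obtain ⟨s, hs, hs0⟩ : ∃ s ∈ sphere x r₀, μ (sphere x r₀ \ {s}) = 0 := by
    rcases hr₀0.eq_or_lt with h0 | h0
    · refine ⟨x, by simp [← h0], ?_⟩
      rw [← h0, sphere_zero, sdiff_self, measure_empty]
    · exact hone _ h0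
  have hfar := ae_eq_zero_of_not_mem_closedBall hf (measure_univ_le_of_closedBall_le h1) hcb
  have hfar' := ae_eq_zero_of_not_mem_closedBall hg
    (measure_univ_le_of_closedBall_le fun r => (heq r) ▸ h1 r) ((heq r₀) ▸ hcb)
  have hsph : ν (sphere x r₀) = ν' (sphere x r₀) := by
    have e1 := measure_ball_add_measure_sphere ν x r₀
    rw [heq, ← measure_ball_add_measure_sphere ν' x r₀, measure_ball_eq_of_closedBall_eq heq] at e1
    refine (ENNReal.add_right_inj ?_).1 e1
    rw [← measure_ball_eq_of_closedBall_eq heq]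
    exact (((measure_mono ball_subset_closedBall).trans (h1 r₀)).trans_lt ENNReal.one_lt_top).ne
  have hval : ∀ k : E → ℝ≥0∞, μ.withDensity k (sphere x r₀) = k s * μ {s} := by
    intro k
    have hae : sphere x r₀ =ᵐ[μ] ({s} : Set E) := by
      have h1 : sphere x r₀ = (sphere x r₀ \ {s}) ∪ {s} := by
        rw [sdiff_union_self, union_eq_self_of_subset_right (singleton_subset_iff.2 hs)]
      rw [h1]
      exact union_ae_eq_right_of_ae_eq_empty (ae_eq_empty.2 hs0)
    rw [withDensity_apply _ isClosed_sphere.measurableSet, setLIntegral_congr hae, lintegral_singleton]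
  have hns : ∀ᵐ y ∂μ, y ∉ sphere x r₀ \ {s} := measure_eq_zero_iff_ae_notMem.1 hs0
  -- The critical sphere has the same mass under both densities, and this mass is the value at `s`
  -- times `μ {s}`. So the values agree unless `s` is not an atom, in which case it is negligible.
  have hatom0 : ∀ᵐ y ∂μ, y = s → f y = g y := by
    by_cases hμs : μ {s} = 0
    · filter_upwards [measure_eq_zero_iff_ae_notMem.1 hμs] with y hy hys using absurd hys hy
    · refine .of_forall fun y hy => ?_
      rw [hν, hν', hval, hval] at hsph
      rw [hy]
      exact (ENNReal.mul_left_inj hμs (hatom s).ne).1 hsph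
  filter_upwards [hfar, hfar', hns, hatom0] with y y1 y2 y3 y4 hy
  rcases lt_trichotomy (dist y x) r₀ with hd | hd | hd
  · exact absurd hy (hlt _ hd)
  · refine y4 ?_
    by_contra hne
    exact y3 ⟨hd, hne⟩
  · have : y ∉ closedBall x r₀ := not_le.2 hd
    rw [y1 this, y2 this]

/-- If `v` exceeds `f` only where the mass of `f` has already reached one, then the masses of `f`
are those of `v`, truncated at one. -/
theorem setLIntegral_closedBall_eq_min {μ : Measure E} {x : E} {f v : E → ℝ≥0∞}
    (h1 : ∀ r, ∫⁻ y in closedBall x r, f y ∂μ ≤ 1) (hfv : f ≤ v)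
    (hv : ∀ y, ∫⁻ z in closedBall x (dist y x), f z ∂μ < 1 → v y = f y) (r : ℝ) :
    ∫⁻ y in closedBall x r, f y ∂μ = min 1 (∫⁻ y in closedBall x r, v y ∂μ) := by
  rcases (h1 r).lt_or_eq with h | h
  · have : ∫⁻ y in closedBall x r, v y ∂μ = ∫⁻ y in closedBall x r, f y ∂μ :=
      setLIntegral_congr_fun measurableSet_closedBall fun y hy =>
        hv y ((lintegral_mono_set (closedBall_subset_closedBall hy)).trans_lt h)
    rw [this, min_eq_right h.le]
  · rw [h, min_eq_left]
    exact h ▸ lintegral_mono hfv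

/-- Both `f` and the accepted part of `v` have, in each ball, the mass of `v` truncated at one.
Where the mass of `f` is still below one, the share is 1 and `v = f`; elsewhere equal radial masses
determine the density. -/
theorem accept_ae_eq {μ : Measure E} {x : E} {f v : E → ℝ≥0∞}
    (hf : Measurable f) (hv : Measurable v) (hacc : Measurable (accept μ x v))
    (hone : ∀ r : ℝ, 0 < r → ∃ s ∈ sphere x r, μ (sphere x r \ {s}) = 0)
    (hfin : ∀ r, μ (closedBall x r) < ∞) (hv1 : ∀ y, v y ≤ 1)
    (h1 : ∀ r, ∫⁻ y in closedBall x r, f y ∂μ ≤ 1) (hfv : f ≤ v)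
    (hvf : ∀ y, ∫⁻ z in closedBall x (dist y x), f z ∂μ < 1 → v y = f y) :
    ∀ᵐ y ∂μ, accept μ x v y = f y := by
  have hvfin : ∀ r, μ.withDensity v (closedBall x r) < ∞ := fun r => by
    rw [withDensity_apply _ measurableSet_closedBall]
    refine (lintegral_mono hv1).trans_lt ?_
    simpa using hfin r
  have hmin := setLIntegral_closedBall_eq_min h1 hfv hvf
  have hatom : ∀ s, μ {s} < ∞ := fun s =>
    (measure_mono (singleton_subset_iff.2 (mem_closedBall.2 le_rfl))).trans_lt (hfin (dist s x))
  filter_upwards [ae_eq_of_one_le_measure_closedBall hf hacc hone hatom h1 fun r => by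
    rw [hmin, setLIntegral_closedBall_accept hv hvfin]] with y hy
  rcases lt_or_ge (∫⁻ z in closedBall x (dist y x), f z ∂μ) 1 with h | h
  · have h' := h
    rw [hmin, min_lt_iff] at h'
    rw [accept, share_of_le, mul_one, hvf y h]
    rw [withDensity_apply _ measurableSet_closedBall]
    exact (h'.resolve_left (lt_irrefl _)).le
  · exact (hy h).symm

end OneVariable

end StableTransport

namespace StableTransport

/-! ### Deferred acceptance: monotonicity, measurability and the limit -/

section Iteration

open Metric Set Filter Topology ProbabilityTheory Function

variable {d : ℕ}

/-- One round of the deferred acceptance procedure. The first component is what the centers leave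
available to the sites, the second one what the sites leave available to the centers. -/
noncomputable def availStep (φ ψ : Measure (Space d))
    (p : (Space d → Space d → ℝ≥0∞) × (Space d → Space d → ℝ≥0∞)) :
    (Space d → Space d → ℝ≥0∞) × (Space d → Space d → ℝ≥0∞) :=
  (fun x ξ => 1 - reject φ ξ (fun x' => p.2 x' ξ) x, fun x ξ => 1 - reject ψ x (p.1 x) ξ)

/-- The availabilities after `n` rounds, started from everything being available to the sites and
nothing being available to the centers. -/
noncomputable def avail (φ ψ : Measure (Space d)) :
    ℕ → (Space d → Space d → ℝ≥0∞) × (Space d → Space d → ℝ≥0∞)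
  | 0 => (fun _ _ => 1, fun _ _ => 0)
  | n + 1 => availStep φ ψ (avail φ ψ n)

theorem avail_succ_fst (φ ψ : Measure (Space d)) (n : ℕ) (x ξ : Space d) :
    (avail φ ψ (n + 1)).1 x ξ = 1 - reject φ ξ (fun x' => (avail φ ψ n).2 x' ξ) x := rfl

theorem avail_succ_snd (φ ψ : Measure (Space d)) (n : ℕ) (x ξ : Space d) :
    (avail φ ψ (n + 1)).2 x ξ = 1 - reject ψ x ((avail φ ψ n).1 x) ξ := rfl

theorem avail_fst_le_one (φ ψ : Measure (Space d)) (n : ℕ) (x ξ : Space d) :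
    (avail φ ψ n).1 x ξ ≤ 1 := by
  cases n with
  | zero => exact le_rfl
  | succ n => exact tsub_le_self

theorem avail_snd_le_one (φ ψ : Measure (Space d)) (n : ℕ) (x ξ : Space d) :
    (avail φ ψ n).2 x ξ ≤ 1 := by
  cases n with
  | zero => exact zero_le
  | succ n => exact tsub_le_self

/-- The initial pair is extremal, and one round preserves the order: smaller offers to one side mean
fewer rejections, hence more available to the other side. -/
theorem avail_succ_le (φ ψ : Measure (Space d)) (n : ℕ) :
    (∀ x ξ, (avail φ ψ (n + 1)).1 x ξ ≤ (avail φ ψ n).1 x ξ) ∧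
      ∀ x ξ, (avail φ ψ n).2 x ξ ≤ (avail φ ψ (n + 1)).2 x ξ := by
  induction n with
  | zero => exact ⟨fun x ξ => avail_fst_le_one _ _ _ _ _, fun x ξ => zero_le⟩
  | succ n ih =>
    refine ⟨fun x ξ => ?_, fun x ξ => ?_⟩
    · rw [avail_succ_fst, avail_succ_fst φ ψ n]
      exact tsub_le_tsub_left (reject_mono (.of_forall fun x' => ih.2 x' ξ) (ih.2 x ξ)) _
    · rw [avail_succ_snd, avail_succ_snd φ ψ (n + 1)]
      exact tsub_le_tsub_left (reject_mono (.of_forall fun ξ' => ih.1 x ξ') (ih.1 x ξ)) _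

theorem antitone_avail_fst (φ ψ : Measure (Space d)) (x ξ : Space d) :
    Antitone fun n => (avail φ ψ n).1 x ξ :=
  antitone_nat_of_succ_le fun n => (avail_succ_le φ ψ n).1 x ξ

theorem monotone_avail_snd (φ ψ : Measure (Space d)) (x ξ : Space d) :
    Monotone fun n => (avail φ ψ n).2 x ξ :=
  monotone_nat_of_le_succ fun n => (avail_succ_le φ ψ n).2 x ξ

/-- The induction step exchanges the roles of the two measures, so they are quantified inside the
statement. -/
theorem avail_snd_swap_le (n : ℕ) : ∀ (φ ψ : Measure (Space d)) (x ξ : Space d),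
    (avail ψ φ n).2 ξ x ≤ (avail φ ψ n).1 x ξ := by
  induction n with
  | zero => exact fun _ _ _ _ => zero_le
  | succ n ih =>
    intro φ ψ x ξ
    rw [avail_succ_fst, avail_succ_snd]
    exact tsub_le_tsub_left (reject_mono (.of_forall fun x' => ih ψ φ ξ x') (ih ψ φ ξ x)) _

/-- What is finally available to the sites. -/
noncomputable def siteAvail (φ ψ : Measure (Space d)) (x ξ : Space d) : ℝ≥0∞ :=
  ⨅ n, (avail φ ψ n).1 x ξ

/-- What is finally available to the centers. -/
noncomputable def centerAvail (φ ψ : Measure (Space d)) (x ξ : Space d) : ℝ≥0∞ :=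
  ⨆ n, (avail φ ψ n).2 x ξ

/-- The density obtained in the limit of the deferred acceptance procedure. -/
noncomputable def limitDensity (φ ψ : Measure (Space d)) (x ξ : Space d) : ℝ≥0∞ :=
  siteAvail φ ψ x ξ + centerAvail φ ψ x ξ - 1

theorem centerAvail_le_one (φ ψ : Measure (Space d)) (x ξ : Space d) : centerAvail φ ψ x ξ ≤ 1 :=
  iSup_le fun n => avail_snd_le_one _ _ n _ _

theorem centerAvail_swap_le_siteAvail (φ ψ : Measure (Space d)) (x ξ : Space d) :
    centerAvail ψ φ ξ x ≤ siteAvail φ ψ x ξ := by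
  refine iSup_le fun m => le_iInf fun n => ?_
  exact ((monotone_avail_snd ψ φ ξ x (le_max_left m n)).trans
    (avail_snd_swap_le (max m n) φ ψ x ξ)).trans (antitone_avail_fst φ ψ x ξ (le_max_right m n))

/-- The additive form avoids truncated subtraction and passes to the limit. -/
theorem accept_avail_fst (φ ψ : Measure (Space d)) (n : ℕ) (x ξ : Space d) :
    accept ψ x ((avail φ ψ n).1 x) ξ + 1 = (avail φ ψ n).1 x ξ + (avail φ ψ (n + 1)).2 x ξ := by
  rw [avail_succ_snd]
  conv_rhs => rw [← accept_add_reject ψ x ((avail φ ψ n).1 x) ξ]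
  rw [add_assoc, add_tsub_cancel_of_le ((reject_le _ _ _ _).trans (avail_fst_le_one _ _ _ _ _))]

theorem accept_avail_snd (φ ψ : Measure (Space d)) (n : ℕ) (x ξ : Space d) :
    accept φ ξ (fun x' => (avail φ ψ n).2 x' ξ) x + 1 =
      (avail φ ψ (n + 1)).1 x ξ + (avail φ ψ n).2 x ξ := by
  rw [avail_succ_fst]
  conv_rhs => rw [← accept_add_reject φ ξ (fun x' => (avail φ ψ n).2 x' ξ) x]
  rw [add_comm (1 - _), add_assoc, add_tsub_cancel_of_le
    ((reject_le φ ξ (fun x' => (avail φ ψ n).2 x' ξ) x).trans (avail_snd_le_one φ ψ n x ξ))]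

theorem tendsto_avail_fst (φ ψ : Measure (Space d)) (x ξ : Space d) :
    Tendsto (fun n => (avail φ ψ n).1 x ξ) atTop (𝓝 (siteAvail φ ψ x ξ)) :=
  tendsto_atTop_iInf (antitone_avail_fst φ ψ x ξ)

theorem tendsto_avail_snd (φ ψ : Measure (Space d)) (x ξ : Space d) :
    Tendsto (fun n => (avail φ ψ n).2 x ξ) atTop (𝓝 (centerAvail φ ψ x ξ)) :=
  tendsto_atTop_iSup (monotone_avail_snd φ ψ x ξ)

/-- The subtraction in `limitDensity` is not truncated, since each approximating sum is an accepted
part plus 1. -/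
theorem limitDensity_add_one (φ ψ : Measure (Space d)) (x ξ : Space d) :
    limitDensity φ ψ x ξ + 1 = siteAvail φ ψ x ξ + centerAvail φ ψ x ξ := by
  refine tsub_add_cancel_of_le ?_
  refine ge_of_tendsto' ((tendsto_avail_fst φ ψ x ξ).add
    ((tendsto_add_atTop_iff_nat 1).2 (tendsto_avail_snd φ ψ x ξ))) fun n => ?_
  rw [← accept_avail_fst]
  exact le_add_self

/-! ### Joint measurability in the outcome, the site and the center -/

section Measurability

variable {Ω : Type*} [MeasurableSpace Ω]

theorem measurable_setLIntegral_kernel (κ : Kernel Ω (Space d)) [IsSFiniteKernel κ]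
    {w : Ω → Space d → Space d → ℝ≥0∞}
    (hw : Measurable fun p : Ω × Space d × Space d => w p.1 p.2.1 p.2.2)
    {A : Space d → ℝ → Set (Space d)}
    (hA : MeasurableSet {q : (Space d × ℝ) × Space d | q.2 ∈ A q.1.1 q.1.2}) :
    Measurable fun p : Ω × Space d × ℝ => ∫⁻ y in A p.2.1 p.2.2, w p.1 p.2.1 y ∂κ p.1 := by
  have hAs : ∀ x r, MeasurableSet (A x r) := fun x r =>
    hA.preimage (measurable_prodMk_left (x := ((x, r) : Space d × ℝ)))
  simp_rw [← lintegral_indicator (hAs _ _)]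
  refine Measurable.lintegral_kernel_prod_right (κ := κ.comap Prod.fst measurable_fst)
    (f := fun (p : Ω × Space d × ℝ) y => (A p.2.1 p.2.2).indicator (w p.1 p.2.1) y) ?_
  have : (uncurry fun (p : Ω × Space d × ℝ) y => (A p.2.1 p.2.2).indicator (w p.1 p.2.1) y) =
      ((fun z : (Ω × Space d × ℝ) × Space d => (z.1.2, z.2)) ⁻¹'
        {q : (Space d × ℝ) × Space d | q.2 ∈ A q.1.1 q.1.2}).indicator
        fun z => w z.1.1 z.1.2.1 z.2 := by
    ext z
    rfl
  rw [this]
  refine Measurable.indicator (hw.comp (by fun_prop : Measurable fun z : (Ω × Space d × ℝ) × Space d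
    => (z.1.1, z.1.2.1, z.2))) (hA.preimage (by fun_prop))

theorem measurable_setLIntegral_closedBall (κ : Kernel Ω (Space d)) [IsSFiniteKernel κ]
    {w : Ω → Space d → Space d → ℝ≥0∞}
    (hw : Measurable fun p : Ω × Space d × Space d => w p.1 p.2.1 p.2.2) :
    Measurable fun p : Ω × Space d × ℝ => ∫⁻ y in closedBall p.2.1 p.2.2, w p.1 p.2.1 y ∂κ p.1 :=
  measurable_setLIntegral_kernel κ hw (A := fun x r => closedBall x r)
    (measurableSet_le (f := fun q : (Space d × ℝ) × Space d => dist q.2 q.1.1) (by fun_prop)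
      (by fun_prop))

theorem measurable_share (κ : Kernel Ω (Space d)) [IsSFiniteKernel κ]
    {w : Ω → Space d → Space d → ℝ≥0∞}
    (hw : Measurable fun p : Ω × Space d × Space d => w p.1 p.2.1 p.2.2) :
    Measurable fun p : Ω × Space d × ℝ =>
      share ((κ p.1).withDensity (w p.1 p.2.1)) p.2.1 p.2.2 := by
  have hc := measurable_setLIntegral_closedBall κ hw
  have hb := measurable_setLIntegral_kernel κ hw (A := fun x r => ball x r)
    (measurableSet_lt (f := fun q : (Space d × ℝ) × Space d => dist q.2 q.1.1) (by fun_prop)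
      (by fun_prop))
  have hs := measurable_setLIntegral_kernel κ hw (A := fun x r => sphere x r)
    (measurableSet_eq_fun (f := fun q : (Space d × ℝ) × Space d => dist q.2 q.1.1) (by fun_prop)
      (by fun_prop))
  simp only [share, withDensity_apply _ measurableSet_closedBall,
    withDensity_apply _ measurableSet_ball, withDensity_apply _ isClosed_sphere.measurableSet]
  exact Measurable.ite (measurableSet_le hc measurable_const) measurable_const
    ((hb.const_sub 1).div hs)

theorem measurable_accept (κ : Kernel Ω (Space d)) [IsSFiniteKernel κ]
    {w : Ω → Space d → Space d → ℝ≥0∞}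
    (hw : Measurable fun p : Ω × Space d × Space d => w p.1 p.2.1 p.2.2) :
    Measurable fun p : Ω × Space d × Space d => accept (κ p.1) p.2.1 (w p.1 p.2.1) p.2.2 := by
  have h := (measurable_share κ hw).comp (by fun_prop : Measurable
    fun p : Ω × Space d × Space d => (p.1, p.2.1, dist p.2.2 p.2.1))
  simp only [Function.comp_def] at h
  simp only [accept]
  exact hw.mul h

theorem measurable_reject (κ : Kernel Ω (Space d)) [IsSFiniteKernel κ]
    {w : Ω → Space d → Space d → ℝ≥0∞}
    (hw : Measurable fun p : Ω × Space d × Space d => w p.1 p.2.1 p.2.2) :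
    Measurable fun p : Ω × Space d × Space d => reject (κ p.1) p.2.1 (w p.1 p.2.1) p.2.2 := by
  have h := (measurable_share κ hw).comp (by fun_prop : Measurable
    fun p : Ω × Space d × Space d => (p.1, p.2.1, dist p.2.2 p.2.1))
  simp only [Function.comp_def] at h
  simp only [reject]
  exact hw.mul (h.const_sub 1)

theorem measurable_prod_swap_right {w : Ω → Space d → Space d → ℝ≥0∞}
    (hw : Measurable fun p : Ω × Space d × Space d => w p.1 p.2.1 p.2.2) :
    Measurable fun p : Ω × Space d × Space d => w p.1 p.2.2 p.2.1 :=
  hw.comp (by fun_prop : Measurable fun p : Ω × Space d × Space d => (p.1, p.2.2, p.2.1))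

theorem measurable_avail (κ η : Kernel Ω (Space d)) [IsSFiniteKernel κ] [IsSFiniteKernel η]
    (n : ℕ) :
    (Measurable fun p : Ω × Space d × Space d => (avail (κ p.1) (η p.1) n).1 p.2.1 p.2.2) ∧
      Measurable fun p : Ω × Space d × Space d => (avail (κ p.1) (η p.1) n).2 p.2.1 p.2.2 := by
  induction n with
  | zero => exact ⟨measurable_const, measurable_const⟩
  | succ n ih =>
    have h1 := (measurable_prod_swap_right
      (w := fun ω ξ x => reject (κ ω) ξ (fun x' => (avail (κ ω) (η ω) n).2 x' ξ) x)
      (measurable_reject κ (w := fun ω ξ x => (avail (κ ω) (η ω) n).2 x ξ)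
        (measurable_prod_swap_right (w := fun ω x ξ => (avail (κ ω) (η ω) n).2 x ξ)
          ih.2))).const_sub 1
    have h2 := (measurable_reject η (w := fun ω x ξ => (avail (κ ω) (η ω) n).1 x ξ) ih.1).const_sub 1
    simp only [avail_succ_fst, avail_succ_snd]
    exact ⟨h1, h2⟩

theorem measurable_siteAvail (κ η : Kernel Ω (Space d)) [IsSFiniteKernel κ] [IsSFiniteKernel η] :
    Measurable fun p : Ω × Space d × Space d => siteAvail (κ p.1) (η p.1) p.2.1 p.2.2 :=
  Measurable.iInf fun n => (measurable_avail κ η n).1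

theorem measurable_centerAvail (κ η : Kernel Ω (Space d)) [IsSFiniteKernel κ] [IsSFiniteKernel η] :
    Measurable fun p : Ω × Space d × Space d => centerAvail (κ p.1) (η p.1) p.2.1 p.2.2 :=
  Measurable.iSup fun n => (measurable_avail κ η n).2

theorem measurable_limitDensity (κ η : Kernel Ω (Space d)) [IsSFiniteKernel κ]
    [IsSFiniteKernel η] :
    Measurable fun p : Ω × Space d × Space d => limitDensity (κ p.1) (η p.1) p.2.1 p.2.2 :=
  ((measurable_siteAvail κ η).add (measurable_centerAvail κ η)).sub measurable_const

end Measurability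

/-! ### Fixed measures, treated as constant kernels over a one-point space -/

section Deterministic

variable (φ ψ : Measure (Space d)) [SFinite φ] [SFinite ψ]

theorem measurable_uncurry_avail_fst (n : ℕ) : Measurable (uncurry (avail φ ψ n).1) :=
  (measurable_avail (Kernel.const Unit φ) (Kernel.const Unit ψ) n).1.comp
    (measurable_prodMk_left (x := ()))

theorem measurable_uncurry_avail_snd (n : ℕ) : Measurable (uncurry (avail φ ψ n).2) :=
  (measurable_avail (Kernel.const Unit φ) (Kernel.const Unit ψ) n).2.comp
    (measurable_prodMk_left (x := ()))

theorem measurable_uncurry_accept {w : Space d → Space d → ℝ≥0∞} (hw : Measurable (uncurry w)) :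
    Measurable (uncurry fun x ξ => accept ψ x (w x) ξ) :=
  (measurable_accept (Kernel.const Unit ψ) (w := fun _ => w) (hw.comp measurable_snd)).comp
    (measurable_prodMk_left (x := ()))

end Deterministic

/-! ### Ball masses of the limit density -/

section Limit

theorem withDensity_closedBall_lt_top {μ : Measure (Space d)} [IsLocallyFiniteMeasure μ]
    {w : Space d → ℝ≥0∞} (hw : ∀ y, w y ≤ 1) (x : Space d) (r : ℝ) :
    μ.withDensity w (closedBall x r) < ∞ := by
  rw [withDensity_apply _ measurableSet_closedBall]
  refine (lintegral_mono hw).trans_lt ?_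
  simpa using (isCompact_closedBall x r).measure_lt_top

/-- If the accepted parts of the offers `w n` are `a n + b n - 1`, then in the limit the mass of
`a + b - 1` in a ball is the mass of the limit of the offers, truncated at one. -/
theorem setLIntegral_limit {μ : Measure (Space d)} [IsLocallyFiniteMeasure μ] {x : Space d}
    {w a b : ℕ → Space d → ℝ≥0∞} {w' a' b' l : Space d → ℝ≥0∞}
    (hw : ∀ n, Measurable (w n)) (ha : ∀ n, Measurable (a n)) (hb : ∀ n, Measurable (b n))
    (hw1 : ∀ n y, w n y ≤ 1) (ha1 : ∀ n y, a n y ≤ 1) (hb1 : ∀ n y, b n y ≤ 1)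
    (hwt : ∀ y, Tendsto (fun n => w n y) atTop (𝓝 (w' y)))
    (hat : ∀ y, Tendsto (fun n => a n y) atTop (𝓝 (a' y)))
    (hbt : ∀ y, Tendsto (fun n => b n y) atTop (𝓝 (b' y)))
    (hacc : ∀ n y, accept μ x (w n) y + 1 = a n y + b n y)
    (hlim : ∀ y, l y + 1 = a' y + b' y) (r : ℝ) :
    ∫⁻ y in closedBall x r, l y ∂μ = min 1 (∫⁻ y in closedBall x r, w' y ∂μ) := by
  have hfin : μ (closedBall x r) < ∞ := (isCompact_closedBall x r).measure_lt_top
  have hconst : ∀ c : ℝ≥0∞, c ≠ ∞ → ∫⁻ _ in closedBall x r, c ∂μ ≠ ∞ := fun c hc => by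
    rw [setLIntegral_const]
    exact ENNReal.mul_ne_top hc hfin.ne
  have h1 : Tendsto (fun n => ∫⁻ y in closedBall x r, (a n y + b n y) ∂μ) atTop
      (𝓝 (∫⁻ y in closedBall x r, (a' y + b' y) ∂μ)) :=
    tendsto_lintegral_of_dominated_convergence (fun _ => 1 + 1)
      (fun n => (ha n).add (hb n))
      (fun n => .of_forall fun y => add_le_add (ha1 n y) (hb1 n y)) (hconst _ (by simp))
      (.of_forall fun y => (hat y).add (hbt y))
  have h2 : Tendsto (fun n => ∫⁻ y in closedBall x r, w n y ∂μ) atTop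
      (𝓝 (∫⁻ y in closedBall x r, w' y ∂μ)) :=
    tendsto_lintegral_of_dominated_convergence (fun _ => 1) hw
      (fun n => .of_forall (hw1 n)) (hconst _ (by simp)) (.of_forall hwt)
  -- The summand 1 contributes the finite mass of the ball, which is cancelled after the passage to
  -- the limit.
  have h3 : ∀ n, ∫⁻ y in closedBall x r, (a n y + b n y) ∂μ =
      min 1 (∫⁻ y in closedBall x r, w n y ∂μ) + μ (closedBall x r) := by
    intro n
    simp_rw [← hacc]
    rw [lintegral_add_right _ measurable_const, setLIntegral_one,
      setLIntegral_closedBall_accept (hw n) (withDensity_closedBall_lt_top (hw1 n) x)]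
  simp_rw [h3, ← hlim] at h1
  rw [lintegral_add_right _ measurable_const, setLIntegral_one] at h1
  have h4 := tendsto_nhds_unique h1 ((tendsto_const_nhds.min h2).add tendsto_const_nhds)
  exact (ENNReal.add_left_inj hfin.ne).1 h4

variable (φ ψ : Measure (Space d)) [IsLocallyFiniteMeasure φ] [IsLocallyFiniteMeasure ψ]

theorem setLIntegral_limitDensity_site (x : Space d) (r : ℝ) :
    ∫⁻ ξ in closedBall x r, limitDensity φ ψ x ξ ∂ψ =
      min 1 (∫⁻ ξ in closedBall x r, siteAvail φ ψ x ξ ∂ψ) :=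
  setLIntegral_limit (w := fun n => (avail φ ψ n).1 x) (a := fun n => (avail φ ψ n).1 x)
    (b := fun n => (avail φ ψ (n + 1)).2 x)
    (fun n => (measurable_uncurry_avail_fst φ ψ n).of_uncurry_left)
    (fun n => (measurable_uncurry_avail_fst φ ψ n).of_uncurry_left)
    (fun n => (measurable_uncurry_avail_snd φ ψ (n + 1)).of_uncurry_left)
    (fun n => avail_fst_le_one φ ψ n x) (fun n => avail_fst_le_one φ ψ n x)
    (fun n => avail_snd_le_one φ ψ (n + 1) x)
    (tendsto_avail_fst φ ψ x) (tendsto_avail_fst φ ψ x)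
    (fun ξ => (tendsto_add_atTop_iff_nat 1).2 (tendsto_avail_snd φ ψ x ξ))
    (fun n => accept_avail_fst φ ψ n x) (limitDensity_add_one φ ψ x) r

theorem setLIntegral_limitDensity_center (ξ : Space d) (r : ℝ) :
    ∫⁻ x in closedBall ξ r, limitDensity φ ψ x ξ ∂φ =
      min 1 (∫⁻ x in closedBall ξ r, centerAvail φ ψ x ξ ∂φ) :=
  setLIntegral_limit (w := fun n x => (avail φ ψ n).2 x ξ)
    (a := fun n x => (avail φ ψ (n + 1)).1 x ξ) (b := fun n x => (avail φ ψ n).2 x ξ)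
    (fun n => (measurable_uncurry_avail_snd φ ψ n).of_uncurry_right)
    (fun n => (measurable_uncurry_avail_fst φ ψ (n + 1)).of_uncurry_right)
    (fun n => (measurable_uncurry_avail_snd φ ψ n).of_uncurry_right)
    (fun n x => avail_snd_le_one φ ψ n x ξ) (fun n x => avail_fst_le_one φ ψ (n + 1) x ξ)
    (fun n x => avail_snd_le_one φ ψ n x ξ)
    (fun x => tendsto_avail_snd φ ψ x ξ)
    (fun x => (tendsto_add_atTop_iff_nat 1).2 (tendsto_avail_fst φ ψ x ξ))
    (fun x => tendsto_avail_snd φ ψ x ξ)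
    (fun n x => accept_avail_snd φ ψ n x ξ) (fun x => limitDensity_add_one φ ψ x ξ) r

end Limit

end Iteration

end StableTransport

namespace StableTransport

/-! ### Comparing stable densities with deferred acceptance -/

section Comparison

open Metric Set Filter Topology ProbabilityTheory Function

variable {d : ℕ} {φ ψ : Measure (Space d)} {f : Space d → Space d → ℝ≥0}

/-- Exchanging the roles of sites and centers preserves stability. -/
theorem IsStableConstrained.swap (hf : IsStableConstrained φ ψ f) :
    IsStableConstrained ψ φ fun ξ x => f x ξ where
  measurable := hf.measurable.comp measurable_swap
  site_le := hf.center_le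
  center_le := hf.site_le
  le_one ξ x := hf.le_one x ξ
  stable := by
    rintro ξ x ⟨⟨h1, h2⟩, ⟨-, h3⟩⟩
    refine hf.stable x ξ ⟨⟨h1, ?_⟩, ⟨h1, ?_⟩⟩
    · simpa only [Sated, Exhausted, dist_comm] using h3
    · simpa only [Sated, Exhausted, dist_comm] using h2

theorem exists_pos_of_setLIntegral_lt {μ : Measure (Space d)} {h : Space d → ℝ≥0} {x : Space d}
    {r : ℝ} (htot : ∫⁻ y, (h y : ℝ≥0∞) ∂μ = 1)
    (hlt : ∫⁻ y in closedBall x r, (h y : ℝ≥0∞) ∂μ < 1) : ∃ y, r < dist x y ∧ 0 < h y := by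
  by_contra! hcon
  refine hlt.ne ?_
  rw [← htot, ← lintegral_indicator measurableSet_closedBall]
  congr 1
  ext y
  by_cases hy : y ∈ closedBall x r
  · rw [indicator_of_mem hy]
  · have h0 : h y = 0 := nonpos_iff_eq_zero.1 (hcon y (by rw [dist_comm]; exact not_le.1 hy))
    rw [indicator_of_notMem hy, h0, ENNReal.coe_zero]

/-- An agent with mass below one in the ball is either unsatisfied or matched partly beyond it. If
the density were below 1, the two would therefore desire each other. -/
theorem IsStableConstrained.eq_one (hf : IsStableConstrained φ ψ f) {x ξ : Space d}
    (hx : ∫⁻ ξ' in closedBall x (dist ξ x), (f x ξ' : ℝ≥0∞) ∂ψ < 1)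
    (hξ : ∫⁻ x' in closedBall ξ (dist x ξ), (f x' ξ : ℝ≥0∞) ∂φ < 1) : f x ξ = 1 := by
  by_contra hne
  have hlt : f x ξ < 1 := lt_of_le_of_ne (hf.le_one x ξ) hne
  refine hf.stable x ξ ⟨⟨hlt, or_iff_not_imp_left.2 fun h => ?_⟩,
    ⟨hlt, or_iff_not_imp_left.2 fun h => ?_⟩⟩
  · obtain ⟨y, hy, hpos⟩ := exists_pos_of_setLIntegral_lt (not_not.1 h) hx
    exact ⟨y, by rwa [dist_comm x ξ], hpos⟩
  · obtain ⟨y, hy, hpos⟩ := exists_pos_of_setLIntegral_lt (not_not.1 h) hξ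
    exact ⟨y, by rwa [dist_comm y ξ], hpos⟩

variable (φ f) in
/-- What the center `ξ` would accept from the site `x`, given the density `f`. -/
noncomputable def siteOffer (x ξ : Space d) : ℝ≥0∞ :=
  open Classical in
  if ∫⁻ x' in closedBall ξ (dist x ξ), (f x' ξ : ℝ≥0∞) ∂φ < 1 then 1 else f x ξ

variable (φ f) in
/-- The complementary offer of the site `x` to the center `ξ`, given the density `f`. -/
noncomputable def centerOffer (x ξ : Space d) : ℝ≥0∞ :=
  open Classical in
  if ∫⁻ x' in closedBall ξ (dist x ξ), (f x' ξ : ℝ≥0∞) ∂φ < 1 then f x ξ else 1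

theorem siteOffer_add_centerOffer (x ξ : Space d) :
    siteOffer φ f x ξ + centerOffer φ f x ξ = f x ξ + 1 := by
  unfold siteOffer centerOffer
  split_ifs
  · exact add_comm _ _
  · rfl

theorem IsConstrained.coe_le_one (hf : IsConstrained φ ψ f) (x ξ : Space d) :
    (f x ξ : ℝ≥0∞) ≤ 1 := by exact_mod_cast hf.le_one x ξ

theorem IsConstrained.le_siteOffer (hf : IsConstrained φ ψ f) (x ξ : Space d) :
    f x ξ ≤ siteOffer φ f x ξ := by
  unfold siteOffer
  split_ifs
  exacts [hf.coe_le_one x ξ, le_rfl]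

theorem IsConstrained.le_centerOffer (hf : IsConstrained φ ψ f) (x ξ : Space d) :
    f x ξ ≤ centerOffer φ f x ξ := by
  unfold centerOffer
  split_ifs
  exacts [le_rfl, hf.coe_le_one x ξ]

theorem IsConstrained.siteOffer_le_one (hf : IsConstrained φ ψ f) (x ξ : Space d) :
    siteOffer φ f x ξ ≤ 1 := by
  unfold siteOffer
  split_ifs
  exacts [le_rfl, hf.coe_le_one x ξ]

theorem IsConstrained.centerOffer_le_one (hf : IsConstrained φ ψ f) (x ξ : Space d) :
    centerOffer φ f x ξ ≤ 1 := by
  unfold centerOffer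
  split_ifs
  exacts [hf.coe_le_one x ξ, le_rfl]

theorem IsStableConstrained.siteOffer_eq (hf : IsStableConstrained φ ψ f) {x ξ : Space d}
    (hx : ∫⁻ ξ' in closedBall x (dist ξ x), (f x ξ' : ℝ≥0∞) ∂ψ < 1) :
    siteOffer φ f x ξ = f x ξ := by
  unfold siteOffer
  split_ifs with h
  · rw [hf.eq_one hx h, ENNReal.coe_one]
  · rfl

theorem centerOffer_eq {x ξ : Space d}
    (hξ : ∫⁻ x' in closedBall ξ (dist x ξ), (f x' ξ : ℝ≥0∞) ∂φ < 1) :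
    centerOffer φ f x ξ = f x ξ := if_pos hξ

theorem measurableSet_setLIntegral_lt_one [SFinite φ]
    (hf : Measurable fun p : Space d × Space d => f p.1 p.2) :
    MeasurableSet {p : Space d × Space d |
      ∫⁻ x' in closedBall p.2 (dist p.1 p.2), (f x' p.2 : ℝ≥0∞) ∂φ < 1} := by
  have h := measurable_setLIntegral_closedBall (Kernel.const Unit φ)
    (w := fun _ ξ x => (f x ξ : ℝ≥0∞))
    (hf.coe_nnreal_ennreal.comp (by fun_prop : Measurable
      fun p : Unit × Space d × Space d => (p.2.2, p.2.1)))
  have h' := h.comp (by fun_prop : Measurable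
    fun p : Space d × Space d => ((), p.2, dist p.1 p.2))
  simp only [Function.comp_def, Kernel.const_apply] at h'
  exact measurableSet_lt h' measurable_const

theorem measurable_uncurry_flip {w : Space d → Space d → ℝ≥0∞} (hw : Measurable (uncurry w)) :
    Measurable (uncurry fun ξ x => w x ξ) := hw.comp measurable_swap

theorem ae_ae_le_comm [SFinite φ] [SFinite ψ] {a b : Space d → Space d → ℝ≥0∞}
    (ha : Measurable (uncurry a)) (hb : Measurable (uncurry b)) :
    (∀ᵐ x ∂φ, ∀ᵐ ξ ∂ψ, a x ξ ≤ b x ξ) ↔ ∀ᵐ ξ ∂ψ, ∀ᵐ x ∂φ, a x ξ ≤ b x ξ :=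
  Measure.ae_ae_comm (measurableSet_le ha hb)

theorem measurable_siteOffer [SFinite φ]
    (hf : Measurable fun p : Space d × Space d => f p.1 p.2) :
    Measurable (uncurry (siteOffer φ f)) :=
  Measurable.ite (measurableSet_setLIntegral_lt_one hf) measurable_const hf.coe_nnreal_ennreal

theorem measurable_centerOffer [SFinite φ]
    (hf : Measurable fun p : Space d × Space d => f p.1 p.2) :
    Measurable (uncurry (centerOffer φ f)) :=
  Measurable.ite (measurableSet_setLIntegral_lt_one hf) hf.coe_nnreal_ennreal measurable_const

theorem one_sub_reject_eq {μ : Measure (Space d)} {x y : Space d} {w : Space d → ℝ≥0∞}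
    {a b : ℝ≥0∞} (ha : a ≠ ∞) (hacc : accept μ x w y = a) (hb : w y + b = a + 1) :
    1 - reject μ x w y = b := by
  rw [← accept_add_reject μ x w y, hacc, add_assoc] at hb
  have h := (ENNReal.add_right_inj ha).1 hb
  have hr : reject μ x w y ≠ ∞ := ne_top_of_le_ne_top ENNReal.one_ne_top (h ▸ le_self_add)
  rw [← h, ENNReal.add_sub_cancel_left hr]

variable [IsLocallyFiniteMeasure φ] [IsLocallyFiniteMeasure ψ]

/-- This is one half of the fixed point property. By stability, `siteOffer` exceeds `f` only where
the site already has mass one, so the site accepts exactly `f`. The other half needs no stability: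
`centerOffer` has the corresponding property by construction. -/
theorem IsStableConstrained.one_sub_reject_siteOffer (hf : IsStableConstrained φ ψ f)
    (hA : ∀ᵐ x ∂φ, SpheresOnePoint ψ x) :
    ∀ᵐ x ∂φ, ∀ᵐ ξ ∂ψ, 1 - reject ψ x (siteOffer φ f x) ξ = centerOffer φ f x ξ := by
  filter_upwards [hA] with x hx
  have hm := measurable_siteOffer (φ := φ) hf.measurable
  have hfm : Measurable fun ξ => (f x ξ : ℝ≥0∞) :=
    (hf.measurable.comp measurable_prodMk_left).coe_nnreal_ennreal
  filter_upwards [accept_ae_eq hfm hm.of_uncurry_left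
    (measurable_uncurry_accept ψ hm).of_uncurry_left hx
    (fun r => (isCompact_closedBall x r).measure_lt_top) (hf.siteOffer_le_one x)
    (fun r => (setLIntegral_le_lintegral _ _).trans (hf.site_le x)) (hf.le_siteOffer x)
    (fun ξ => hf.siteOffer_eq)] with ξ hξ
  exact one_sub_reject_eq ENNReal.coe_ne_top hξ (siteOffer_add_centerOffer x ξ)

theorem IsStableConstrained.one_sub_reject_centerOffer (hf : IsStableConstrained φ ψ f)
    (hA : ∀ᵐ ξ ∂ψ, SpheresOnePoint φ ξ) :
    ∀ᵐ ξ ∂ψ, ∀ᵐ x ∂φ, 1 - reject φ ξ (fun x' => centerOffer φ f x' ξ) x = siteOffer φ f x ξ := by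
  filter_upwards [hA] with ξ hξ
  have hm : Measurable (uncurry fun ξ x => centerOffer φ f x ξ) :=
    measurable_uncurry_flip (measurable_centerOffer hf.measurable)
  have hfm : Measurable fun x => (f x ξ : ℝ≥0∞) :=
    (hf.measurable.comp measurable_prodMk_right).coe_nnreal_ennreal
  have hv : Measurable fun x => centerOffer φ f x ξ := hm.of_uncurry_left
  have hacc : Measurable (accept φ ξ fun x => centerOffer φ f x ξ) :=
    (measurable_uncurry_accept φ hm).of_uncurry_left
  have key : ∀ᵐ x ∂φ, accept φ ξ (fun x' => centerOffer φ f x' ξ) x = f x ξ :=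
    accept_ae_eq hfm hv hacc hξ
      (fun r => (isCompact_closedBall ξ r).measure_lt_top) (fun x => hf.centerOffer_le_one x ξ)
      (fun r => (setLIntegral_le_lintegral _ _).trans (hf.center_le ξ))
      (fun x => hf.le_centerOffer x ξ) (fun x => centerOffer_eq)
  filter_upwards [key] with x hx
  refine one_sub_reject_eq ENNReal.coe_ne_top hx ?_
  rw [← siteOffer_add_centerOffer x ξ, add_comm]

/-- Every stable constrained density is bounded by the deferred acceptance procedure: it makes
less available to the sites and more available to the centers. -/
theorem IsStableConstrained.offer_le_avail (hf : IsStableConstrained φ ψ f)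
    (hA : UniquenessAssumption φ ψ) (n : ℕ) :
    (∀ᵐ ξ ∂ψ, ∀ᵐ x ∂φ, siteOffer φ f x ξ ≤ (avail φ ψ n).1 x ξ) ∧
      ∀ᵐ x ∂φ, ∀ᵐ ξ ∂ψ, (avail φ ψ n).2 x ξ ≤ centerOffer φ f x ξ := by
  induction n with
  | zero =>
    exact ⟨.of_forall fun ξ => .of_forall fun x => hf.siteOffer_le_one x ξ,
      .of_forall fun x => .of_forall fun ξ => zero_le⟩
  | succ n ih =>
    obtain ⟨ih1, ih2⟩ := ih
    -- By Fubini the quantifiers are exchanged, so that each bound holds along the fiber on which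
    -- the next rejection is computed.
    rw [← ae_ae_le_comm (measurable_siteOffer hf.measurable)
      (measurable_uncurry_avail_fst φ ψ n)] at ih1
    rw [ae_ae_le_comm (measurable_uncurry_avail_snd φ ψ n)
      (measurable_centerOffer hf.measurable)] at ih2
    constructor
    · filter_upwards [ih2, hf.one_sub_reject_centerOffer hA.2] with ξ h1 h2
      filter_upwards [h1, h2] with x h3 h4
      rw [← h4, avail_succ_fst]
      exact tsub_le_tsub_left (reject_mono h1 h3) _
    · filter_upwards [ih1, hf.one_sub_reject_siteOffer hA.1] with x h1 h2
      filter_upwards [h1, h2] with ξ h3 h4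
      rw [← h4, avail_succ_snd]
      exact tsub_le_tsub_left (reject_mono h1 h3) _

theorem IsStableConstrained.site_le_siteAvail (hf : IsStableConstrained φ ψ f)
    (hA : UniquenessAssumption φ ψ) :
    ∀ᵐ x ∂φ, ∀ r, ∫⁻ ξ in closedBall x r, (f x ξ : ℝ≥0∞) ∂ψ ≤
      min 1 (∫⁻ ξ in closedBall x r, siteAvail φ ψ x ξ ∂ψ) := by
  have h : ∀ᵐ x ∂φ, ∀ n, ∀ᵐ ξ ∂ψ, siteOffer φ f x ξ ≤ (avail φ ψ n).1 x ξ := by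
    refine ae_all_iff.2 fun n => ?_
    rw [ae_ae_le_comm (measurable_siteOffer hf.measurable)
      (measurable_uncurry_avail_fst φ ψ n)]
    exact (hf.offer_le_avail hA n).1
  filter_upwards [h] with x hx r
  refine le_min ((setLIntegral_le_lintegral _ _).trans (hf.site_le x)) ?_
  refine lintegral_mono_ae (ae_restrict_of_ae ?_)
  filter_upwards [ae_all_iff.2 hx] with ξ hξ
  exact le_iInf fun n => (hf.le_siteOffer x ξ).trans (hξ n)

theorem IsStableConstrained.centerAvail_le_center (hf : IsStableConstrained φ ψ f)
    (hA : UniquenessAssumption φ ψ) :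
    ∀ᵐ ξ ∂ψ, ∀ r, min 1 (∫⁻ x in closedBall ξ r, centerAvail φ ψ x ξ ∂φ) ≤
      ∫⁻ x in closedBall ξ r, (f x ξ : ℝ≥0∞) ∂φ := by
  have h : ∀ᵐ ξ ∂ψ, ∀ n, ∀ᵐ x ∂φ, (avail φ ψ n).2 x ξ ≤ centerOffer φ f x ξ := by
    refine ae_all_iff.2 fun n => ?_
    rw [← ae_ae_le_comm (measurable_uncurry_avail_snd φ ψ n)
      (measurable_centerOffer hf.measurable)]
    exact (hf.offer_le_avail hA n).2
  filter_upwards [h] with ξ hξ r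
  -- The inequality `f ≤ centerOffer` points the wrong way; after truncation at one the masses are
  -- equal.
  rw [setLIntegral_closedBall_eq_min (v := fun x => centerOffer φ f x ξ)
    (fun r => (setLIntegral_le_lintegral _ _).trans (hf.center_le ξ))
    (fun x => hf.le_centerOffer x ξ) (fun x => centerOffer_eq)]
  refine min_le_min_left _ (lintegral_mono_ae (ae_restrict_of_ae ?_))
  filter_upwards [ae_all_iff.2 hξ] with x hx
  exact iSup_le hx

/-- If the two versions of the deferred acceptance procedure give the same masses, then the stable
constrained density is unique. -/
theorem IsStableConstrained.ae_eq {g : Space d → Space d → ℝ≥0}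
    (hf : IsStableConstrained φ ψ f) (hg : IsStableConstrained φ ψ g)
    (hA : UniquenessAssumption φ ψ)
    (hsite : ∀ᵐ x ∂φ, ∀ r, min 1 (∫⁻ ξ in closedBall x r, siteAvail φ ψ x ξ ∂ψ) ≤
      min 1 (∫⁻ ξ in closedBall x r, centerAvail ψ φ ξ x ∂ψ))
    (hcenter : ∀ᵐ ξ ∂ψ, ∀ r, min 1 (∫⁻ x in closedBall ξ r, siteAvail ψ φ ξ x ∂φ) ≤
      min 1 (∫⁻ x in closedBall ξ r, centerAvail φ ψ x ξ ∂φ)) :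
    ∀ᵐ p ∂(φ.prod ψ), f p.1 p.2 = g p.1 p.2 := by
  have hA' : UniquenessAssumption ψ φ := ⟨hA.2, hA.1⟩
  have hfm := hf.measurable.coe_nnreal_ennreal
  have hgm := hg.measurable.coe_nnreal_ennreal
  have hx : ∀ᵐ x ∂φ, ∀ᵐ ξ ∂ψ, (∫⁻ ξ' in closedBall x (dist ξ x), (f x ξ' : ℝ≥0∞) ∂ψ < 1 ∧
      ∫⁻ ξ' in closedBall x (dist ξ x), (g x ξ' : ℝ≥0∞) ∂ψ < 1) ∨ f x ξ = g x ξ := by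
    filter_upwards [hA.1, hsite, hf.site_le_siteAvail hA, hg.site_le_siteAvail hA,
      hf.swap.centerAvail_le_center hA', hg.swap.centerAvail_le_center hA']
      with x h0 h1 h2 h3 h4 h5
    have hatom : ∀ s, ψ {s} < ∞ := fun s => isCompact_singleton.measure_lt_top
    -- Each density has at most the mass of the site-proposing procedure and at least that of the
    -- center-proposing one; `hsite` closes the gap.
    have heq : ∀ r, ∫⁻ ξ in closedBall x r, (f x ξ : ℝ≥0∞) ∂ψ = ∫⁻ ξ in closedBall x r, (g x ξ : ℝ≥0∞) ∂ψ :=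
      fun r => le_antisymm (((h2 r).trans (h1 r)).trans (h5 r)) (((h3 r).trans (h1 r)).trans (h4 r))
    filter_upwards [ae_eq_of_one_le_measure_closedBall
      (hfm.comp (measurable_prodMk_left (x := x))) (hgm.comp (measurable_prodMk_left (x := x)))
      h0 hatom (fun r => (setLIntegral_le_lintegral _ _).trans (hf.site_le x)) heq] with ξ hξ
    rw [← heq, and_self]
    exact (lt_or_ge _ _).imp id fun h => ENNReal.coe_injective (hξ h)
  have hξ : ∀ᵐ ξ ∂ψ, ∀ᵐ x ∂φ, (∫⁻ x' in closedBall ξ (dist x ξ), (f x' ξ : ℝ≥0∞) ∂φ < 1 ∧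
      ∫⁻ x' in closedBall ξ (dist x ξ), (g x' ξ : ℝ≥0∞) ∂φ < 1) ∨ f x ξ = g x ξ := by
    filter_upwards [hA.2, hcenter, hf.swap.site_le_siteAvail hA', hg.swap.site_le_siteAvail hA',
      hf.centerAvail_le_center hA, hg.centerAvail_le_center hA]
      with ξ h0 h1 h2 h3 h4 h5
    have hatom : ∀ s, φ {s} < ∞ := fun s => isCompact_singleton.measure_lt_top
    have heq : ∀ r, ∫⁻ x in closedBall ξ r, (f x ξ : ℝ≥0∞) ∂φ = ∫⁻ x in closedBall ξ r, (g x ξ : ℝ≥0∞) ∂φ :=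
      fun r => le_antisymm (((h2 r).trans (h1 r)).trans (h5 r)) (((h3 r).trans (h1 r)).trans (h4 r))
    filter_upwards [ae_eq_of_one_le_measure_closedBall
      (hfm.comp (measurable_prodMk_right (y := ξ))) (hgm.comp (measurable_prodMk_right (y := ξ)))
      h0 hatom (fun r => (setLIntegral_le_lintegral _ _).trans (hf.center_le ξ)) heq] with x hx
    rw [← heq, and_self]
    exact (lt_or_ge _ _).imp id fun h => ENNReal.coe_injective (hx h)
  have hms : MeasurableSet {p : Space d × Space d |
      (∫⁻ x' in closedBall p.2 (dist p.1 p.2), (f x' p.2 : ℝ≥0∞) ∂φ < 1 ∧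
        ∫⁻ x' in closedBall p.2 (dist p.1 p.2), (g x' p.2 : ℝ≥0∞) ∂φ < 1) ∨
        f p.1 p.2 = g p.1 p.2} :=
    ((measurableSet_setLIntegral_lt_one hf.measurable).inter
      (measurableSet_setLIntegral_lt_one hg.measurable)).union
      (measurableSet_eq_fun hf.measurable hg.measurable)
  rw [← Measure.ae_ae_comm (p := fun x ξ =>
      (∫⁻ x' in closedBall ξ (dist x ξ), (f x' ξ : ℝ≥0∞) ∂φ < 1 ∧
        ∫⁻ x' in closedBall ξ (dist x ξ), (g x' ξ : ℝ≥0∞) ∂φ < 1) ∨ f x ξ = g x ξ) hms] at hξ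
  refine (Measure.ae_prod_iff_ae_ae (measurableSet_eq_fun hf.measurable hg.measurable)).2 ?_
  filter_upwards [hx, hξ] with x h1 h2
  filter_upwards [h1, h2] with ξ h3 h4
  -- If neither endpoint settles the matter, all four masses are below one, and stability gives the
  -- value 1 for both densities.
  rcases h3 with h3 | h3
  · rcases h4 with h4 | h4
    · rw [hf.eq_one h3.1 h4.1, hg.eq_one h3.2 h4.2]
    · exact h4
  · exact h3

end Comparison

end StableTransport

namespace StableTransport

/-! ### Shift equivariance and the mass transport principle -/

section MassTransport

open Metric Set Filter Topology ProbabilityTheory Function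

variable {d : ℕ}

theorem lintegral_shift (s : Space d) (μ : Measure (Space d)) (w : Space d → ℝ≥0∞) :
    ∫⁻ y, w y ∂(shift s μ) = ∫⁻ y, w (y - s) ∂μ :=
  lintegral_map_equiv w (MeasurableEquiv.subRight s)

theorem withDensity_shift_apply (s : Space d) (μ : Measure (Space d)) (w : Space d → ℝ≥0∞)
    {A B : Set (Space d)} (hA : MeasurableSet A) (hB : MeasurableSet B)
    (hAB : ∀ y, y - s ∈ A ↔ y ∈ B) :
    (shift s μ).withDensity w A = μ.withDensity (fun z => w (z - s)) B := by
  rw [withDensity_apply _ hA, withDensity_apply _ hB, ← lintegral_indicator hA,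
    ← lintegral_indicator hB, lintegral_shift]
  congr 1
  ext y
  by_cases hy : y ∈ B
  · rw [indicator_of_mem hy, indicator_of_mem ((hAB y).2 hy)]
  · rw [indicator_of_notMem hy, indicator_of_notMem (mt (hAB y).1 hy)]

theorem reject_shift (s : Space d) (μ : Measure (Space d)) (w : Space d → ℝ≥0∞) (x y : Space d) :
    reject (shift s μ) x w y = reject μ (x + s) (fun z => w (z - s)) (y + s) := by
  have hd : ∀ y : Space d, dist (y - s) x = dist y (x + s) := fun y => by
    rw [dist_eq_norm, dist_eq_norm, sub_sub, add_comm s]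
  simp only [reject, share, add_sub_cancel_right, dist_add_right]
  rw [withDensity_shift_apply s μ w measurableSet_closedBall
      (measurableSet_closedBall (x := x + s) (ε := dist y x)) fun z => by
        rw [mem_closedBall, mem_closedBall, hd],
    withDensity_shift_apply s μ w measurableSet_ball
      (measurableSet_ball (x := x + s) (ε := dist y x)) fun z => by
        rw [mem_ball, mem_ball, hd],
    withDensity_shift_apply s μ w isClosed_sphere.measurableSet
      (isClosed_sphere (x := x + s) (ε := dist y x)).measurableSet fun z => by
        rw [mem_sphere, mem_sphere, hd]]

theorem avail_shift (s : Space d) (φ ψ : Measure (Space d)) (n : ℕ) :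
    (∀ x ξ, (avail (shift s φ) (shift s ψ) n).1 x ξ = (avail φ ψ n).1 (x + s) (ξ + s)) ∧
      ∀ x ξ, (avail (shift s φ) (shift s ψ) n).2 x ξ = (avail φ ψ n).2 (x + s) (ξ + s) := by
  induction n with
  | zero => exact ⟨fun _ _ => rfl, fun _ _ => rfl⟩
  | succ n ih =>
    refine ⟨fun x ξ => ?_, fun x ξ => ?_⟩
    · rw [avail_succ_fst, avail_succ_fst, reject_shift]
      simp only [ih.2, sub_add_cancel]
    · rw [avail_succ_snd, avail_succ_snd, reject_shift]
      simp only [ih.1, sub_add_cancel]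

theorem limitDensity_shift (s : Space d) (φ ψ : Measure (Space d)) (x ξ : Space d) :
    limitDensity (shift s φ) (shift s ψ) x ξ = limitDensity φ ψ (x + s) (ξ + s) := by
  simp only [limitDensity, siteAvail, centerAvail, (avail_shift s φ ψ _).1,
    (avail_shift s φ ψ _).2]

variable {Ω : Type*} [MeasurableSpace Ω]

theorem lintegral_compProd_prod (P : Measure Ω) [SFinite P] (κ η : Kernel Ω (Space d))
    [IsSFiniteKernel κ] [IsSFiniteKernel η] {h : Ω × Space d × Space d → ℝ≥0∞}
    (hh : Measurable h) :
    ∫⁻ p, h p ∂(P ⊗ₘ (κ ×ₖ η)) = ∫⁻ ω, ∫⁻ x, ∫⁻ ξ, h (ω, x, ξ) ∂η ω ∂κ ω ∂P := by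
  rw [Measure.lintegral_compProd hh]
  refine lintegral_congr fun ω => ?_
  rw [Kernel.prod_apply, lintegral_prod (fun q => h (ω, q))
    (hh.comp measurable_prodMk_left).aemeasurable]

variable {θ : Space d → Ω → Ω} {P : Measure Ω} {κ η : Kernel Ω (Space d)}

/-- Invariance of `P` permits replacing `ω` by `θ t ω`, and adaptedness turns this into a diagonal
translation of the two points. -/
theorem lintegral_compProd_prod_flow [SFinite P] [IsSFiniteKernel κ] [IsSFiniteKernel η]
    (hθ : IsMeasurableFlow θ) (hP : IsStationaryProb θ P)
    (hκ : ∀ s ω, κ (θ s ω) = shift s (κ ω)) (hη : ∀ s ω, η (θ s ω) = shift s (η ω))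
    {h : Ω × Space d × Space d → ℝ≥0∞} (hh : Measurable h) (t : Space d) :
    ∫⁻ p, h p ∂(P ⊗ₘ (κ ×ₖ η)) =
      ∫⁻ p, h (θ t p.1, p.2.1 - t, p.2.2 - t) ∂(P ⊗ₘ (κ ×ₖ η)) := by
  have hθt : Measurable (θ t) := hθ.measurable.comp (measurable_prodMk_right (y := t))
  rw [lintegral_compProd_prod P κ η hh, lintegral_compProd_prod P κ η
    (h := fun p => h (θ t p.1, p.2.1 - t, p.2.2 - t)) (by fun_prop)]
  have hm : Measurable fun ω => ∫⁻ x, ∫⁻ ξ, h (ω, x, ξ) ∂η ω ∂κ ω := by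
    refine Measurable.lintegral_kernel_prod_right (κ := κ) (f := fun ω x => ∫⁻ ξ, h (ω, x, ξ) ∂η ω) ?_
    exact Measurable.lintegral_kernel_prod_right (κ := η.comap Prod.fst measurable_fst)
      (f := fun (p : Ω × Space d) ξ => h (p.1, p.2, ξ)) (hh.comp (by fun_prop))
  conv_lhs => rw [← hP t]
  rw [lintegral_map hm hθt]
  simp only [hκ, hη, lintegral_shift]

/-- The mass transport principle. -/
theorem massTransport [SFinite P] [IsSFiniteKernel κ] [IsSFiniteKernel η]
    (hθ : IsMeasurableFlow θ) (hP : IsStationaryProb θ P)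
    (hκ : ∀ s ω, κ (θ s ω) = shift s (κ ω)) (hη : ∀ s ω, η (θ s ω) = shift s (η ω))
    {w : Ω × Space d × Space d → ℝ≥0∞} (hw : Measurable w)
    (hinv : ∀ s ω x ξ, w (θ s ω, x, ξ) = w (ω, x + s, ξ + s))
    {B : Set (Space d)} (hB : MeasurableSet B) (hB0 : volume B ≠ 0) (hBt : volume B ≠ ∞) :
    ∫⁻ p, B.indicator 1 p.2.1 * w p ∂(P ⊗ₘ (κ ×ₖ η)) =
      ∫⁻ p, B.indicator 1 p.2.2 * w p ∂(P ⊗ₘ (κ ×ₖ η)) := by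
  set M := P ⊗ₘ (κ ×ₖ η) with hM
  have hI : Measurable (B.indicator (1 : Space d → ℝ≥0∞)) := measurable_one.indicator hB
  have hvol : ∫⁻ t, B.indicator (1 : Space d → ℝ≥0∞) t = volume B := lintegral_indicator_one hB
  -- The factor `volume B` is an integral over translations of a second indicator. The diagonal
  -- shift by `t` turns the indicators at `x` and `ξ + t` into those at `x - t` and `ξ`, which
  -- exchanges the roles of the two points.
  have h1 : (∫⁻ p, B.indicator 1 p.2.1 * w p ∂M) * volume B =
      ∫⁻ t : Space d, ∫⁻ p, B.indicator 1 p.2.1 * w p * B.indicator 1 (p.2.2 + t) ∂M := by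
    rw [← lintegral_mul_const _ (by fun_prop), lintegral_lintegral_swap (by fun_prop)]
    refine lintegral_congr fun p => ?_
    rw [lintegral_const_mul _ (by fun_prop), lintegral_add_left_eq_self, hvol]
  have h2 : (∫⁻ p, B.indicator 1 p.2.2 * w p ∂M) * volume B =
      ∫⁻ t : Space d, ∫⁻ p, B.indicator 1 p.2.2 * w p * B.indicator 1 (p.2.1 - t) ∂M := by
    rw [← lintegral_mul_const _ (by fun_prop), lintegral_lintegral_swap (by fun_prop)]
    refine lintegral_congr fun p => ?_
    rw [lintegral_const_mul _ (by fun_prop), lintegral_sub_left_eq_self, hvol]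
  have h3 : (∫⁻ p, B.indicator 1 p.2.1 * w p ∂M) * volume B =
      (∫⁻ p, B.indicator 1 p.2.2 * w p ∂M) * volume B := by
    rw [h1, h2]
    refine lintegral_congr fun t => ?_
    rw [hM, lintegral_compProd_prod_flow hθ hP hκ hη (by fun_prop) t]
    refine lintegral_congr fun p => ?_
    simp only [hinv, sub_add_cancel]
    ring
  exact (ENNReal.mul_left_inj hB0 hBt).1 h3

/-- A measurable family of locally finite measures is an s-finite kernel. -/
theorem isSFiniteKernel_of_isLocallyFinite (κ : Kernel Ω (Space d))
    (h : ∀ ω, IsLocallyFiniteMeasure (κ ω)) : IsSFiniteKernel κ := by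
  have hS : ∀ n, MeasurableSet (disjointed (fun n : ℕ => closedBall (0 : Space d) n) n) :=
    fun n => MeasurableSet.disjointed (fun n => measurableSet_closedBall) n
  have hfin : ∀ ω n, κ ω (disjointed (fun n : ℕ => closedBall (0 : Space d) n) n) < ∞ := by
    intro ω n
    have := h ω
    exact (measure_mono (disjointed_subset _ n)).trans_lt (isCompact_closedBall _ _).measure_lt_top
  have hsum : κ = Kernel.sum fun n => κ.restrict (hS n) := by
    ext ω A hA
    rw [Kernel.sum_apply' _ _ hA]
    simp only [Kernel.restrict_apply]
    rw [← Measure.sum_apply _ hA, ← Measure.restrict_iUnion (disjoint_disjointed _) hS,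
      iUnion_disjointed, iUnion_closedBall_nat, Measure.restrict_univ]
  have hpart : ∀ n, IsSFiniteKernel (κ.restrict (hS n)) := by
    intro n
    set S := disjointed (fun n : ℕ => closedBall (0 : Space d) n) n
    have hm : Measurable fun ω => κ ω S := κ.measurable_coe (hS n)
    -- A finite kernel needs a bound uniform in `ω`, so the outcomes are split by the integer part
    -- of the mass of the piece `S`.
    have hT : ∀ k : ℕ, MeasurableSet {ω | ⌊(κ ω S).toReal⌋₊ = k} := fun k =>
      (Nat.measurable_floor.comp hm.ennreal_toReal) (measurableSet_singleton k)
    classical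
    have hsum' : κ.restrict (hS n) =
        Kernel.sum fun k => Kernel.piecewise (hT k) (κ.restrict (hS n)) 0 := by
      ext ω A hA
      rw [Kernel.sum_apply' _ _ hA, tsum_eq_single ⌊(κ ω S).toReal⌋₊]
      · rw [Kernel.piecewise_apply, if_pos (mem_ofPred_eq ▸ rfl)]
      · intro k hk
        have hω : ω ∉ {ω | ⌊(κ ω S).toReal⌋₊ = k} := fun h => hk (Eq.symm h)
        rw [Kernel.piecewise_apply, if_neg hω]
        rfl
    rw [hsum']
    refine Kernel.isSFiniteKernel_sum (hκs := fun k => ?_)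
    have : IsFiniteKernel (Kernel.piecewise (hT k) (κ.restrict (hS n)) 0) := by
      refine ⟨⟨k + 1, by simp, fun ω => ?_⟩⟩
      rw [Kernel.piecewise_apply]
      split_ifs with hω
      · rw [Kernel.restrict_apply, Measure.restrict_apply_univ]
        have h1 : (κ ω S).toReal < k + 1 := by
          rw [← (show ⌊(κ ω S).toReal⌋₊ = k from hω)]
          exact Nat.lt_floor_add_one _
        rw [← ENNReal.ofReal_toReal (hfin ω n).ne]
        refine (ENNReal.ofReal_le_ofReal h1.le).trans ?_
        rw [ENNReal.ofReal_add (by positivity) zero_le_one]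
        simp
      · simp
    infer_instance
  rw [hsum]
  exact Kernel.isSFiniteKernel_sum

end MassTransport

end StableTransport

namespace StableTransport

/-! ### Equality of the two extremal procedures -/

section Uniqueness

open Metric Set Filter Topology ProbabilityTheory Function

variable {d : ℕ} {Ω : Type*} [MeasurableSpace Ω]

/-- The mass which the site-proposing procedure transports from `x` over distances at most `r`. -/
noncomputable def siteMass (φ ψ : Measure (Space d)) (r : ℝ) (x : Space d) : ℝ≥0∞ :=
  min 1 (∫⁻ ξ in closedBall x r, siteAvail φ ψ x ξ ∂ψ)

/-- The mass which the site-proposing procedure transports to `ξ` over distances at most `r`. -/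
noncomputable def centerMass (φ ψ : Measure (Space d)) (r : ℝ) (ξ : Space d) : ℝ≥0∞ :=
  min 1 (∫⁻ x in closedBall ξ r, centerAvail φ ψ x ξ ∂φ)

theorem centerMass_swap_le_siteMass (φ ψ : Measure (Space d)) (r : ℝ) (x : Space d) :
    centerMass ψ φ r x ≤ siteMass φ ψ r x :=
  min_le_min_left _ (lintegral_mono fun ξ => centerAvail_swap_le_siteAvail φ ψ x ξ)

variable {θ : Space d → Ω → Ω} {P : Measure Ω} {κ η : Kernel Ω (Space d)}

theorem measurable_siteMass [IsSFiniteKernel κ] [IsSFiniteKernel η] (r : ℝ) :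
    Measurable fun p : Ω × Space d => siteMass (κ p.1) (η p.1) r p.2 := by
  have h := (measurable_setLIntegral_closedBall η
    (w := fun ω x ξ => siteAvail (κ ω) (η ω) x ξ) (measurable_siteAvail κ η)).comp
    (by fun_prop : Measurable fun p : Ω × Space d => (p.1, p.2, r))
  simp only [Function.comp_def] at h
  exact measurable_const.min h

theorem measurable_centerMass [IsSFiniteKernel κ] [IsSFiniteKernel η] (r : ℝ) :
    Measurable fun p : Ω × Space d => centerMass (κ p.1) (η p.1) r p.2 := by
  have h := (measurable_setLIntegral_closedBall κ
    (w := fun ω ξ x => centerAvail (κ ω) (η ω) x ξ)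
    (measurable_prod_swap_right (w := fun ω x ξ => centerAvail (κ ω) (η ω) x ξ)
      (measurable_centerAvail κ η))).comp
    (by fun_prop : Measurable fun p : Ω × Space d => (p.1, p.2, r))
  simp only [Function.comp_def] at h
  exact measurable_const.min h

/-- The expected mass sent from `B` equals the expected mass received in `B`. -/
theorem lintegral_siteMass_eq [SFinite P] [IsSFiniteKernel κ] [IsSFiniteKernel η]
    (hθ : IsMeasurableFlow θ) (hP : IsStationaryProb θ P)
    (hκ : ∀ s ω, κ (θ s ω) = shift s (κ ω)) (hη : ∀ s ω, η (θ s ω) = shift s (η ω))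
    (hκf : ∀ ω, IsLocallyFiniteMeasure (κ ω)) (hηf : ∀ ω, IsLocallyFiniteMeasure (η ω))
    {B : Set (Space d)} (hB : MeasurableSet B) (hB0 : volume B ≠ 0) (hBt : volume B ≠ ∞) (r : ℝ) :
    ∫⁻ ω, ∫⁻ x, B.indicator 1 x * siteMass (κ ω) (η ω) r x ∂κ ω ∂P =
      ∫⁻ ω, ∫⁻ ξ, B.indicator 1 ξ * centerMass (κ ω) (η ω) r ξ ∂η ω ∂P := by
  -- Transport by the limit density over distances at most `r`: the mass sent is `siteMass` and the
  -- mass received is `centerMass`.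
  set w : Ω × Space d × Space d → ℝ≥0∞ := {p | dist p.2.2 p.2.1 ≤ r}.indicator
    fun p => limitDensity (κ p.1) (η p.1) p.2.1 p.2.2 with hw_def
  have hw : Measurable w := (measurable_limitDensity κ η).indicator
    (measurableSet_le (by fun_prop) measurable_const)
  have hI : Measurable (B.indicator (1 : Space d → ℝ≥0∞)) := measurable_one.indicator hB
  have hinv : ∀ s ω x ξ, w (θ s ω, x, ξ) = w (ω, x + s, ξ + s) := by
    intro s ω x ξ
    simp only [hw_def, indicator, mem_ofPred_eq, dist_add_right, hκ, hη, limitDensity_shift]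
  have hsite : ∀ ω x, ∫⁻ ξ, w (ω, x, ξ) ∂η ω = siteMass (κ ω) (η ω) r x := by
    intro ω x
    have := hκf ω
    have := hηf ω
    rw [siteMass, ← setLIntegral_limitDensity_site, ← lintegral_indicator measurableSet_closedBall]
    rfl
  have hcenter : ∀ ω ξ, ∫⁻ x, w (ω, x, ξ) ∂κ ω = centerMass (κ ω) (η ω) r ξ := by
    intro ω ξ
    have := hκf ω
    have := hηf ω
    rw [centerMass, ← setLIntegral_limitDensity_center,
      ← lintegral_indicator measurableSet_closedBall]
    refine lintegral_congr fun x => ?_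
    simp only [hw_def, indicator, mem_ofPred_eq, mem_closedBall, dist_comm]
  have key := massTransport hθ hP hκ hη hw hinv hB hB0 hBt
  rw [lintegral_compProd_prod P κ η (by fun_prop), lintegral_compProd_prod P κ η (by fun_prop)]
    at key
  convert key using 1
  · refine lintegral_congr fun ω => lintegral_congr fun x => ?_
    rw [← hsite, ← lintegral_const_mul _ (by fun_prop)]
  · refine lintegral_congr fun ω => ?_
    rw [lintegral_lintegral_swap (by fun_prop)]
    refine lintegral_congr fun ξ => ?_
    rw [← hcenter, ← lintegral_const_mul _ (by fun_prop)]

/-- The pointwise inequality is the opposite one. Transport by the site-proposing procedure, the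
pointwise inequality at the centers, and transport by the center-proposing procedure give the claim
in expectation. As the expectation is finite, equality holds almost everywhere. -/
theorem ae_siteMass_le_centerMass_of_measurableSet [SFinite P] [IsSFiniteKernel κ]
    [IsSFiniteKernel η]
    (hθ : IsMeasurableFlow θ) (hP : IsStationaryProb θ P)
    (hκ : ∀ s ω, κ (θ s ω) = shift s (κ ω)) (hη : ∀ s ω, η (θ s ω) = shift s (η ω))
    (hκf : ∀ ω, IsLocallyFiniteMeasure (κ ω)) (hηf : ∀ ω, IsLocallyFiniteMeasure (η ω))
    {B : Set (Space d)} (hB : MeasurableSet B) (hB0 : volume B ≠ 0) (hBt : volume B ≠ ∞)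
    (hint : ∫⁻ ω, κ ω B ∂P ≠ ∞) (r : ℝ) :
    ∀ᵐ ω ∂P, ∀ᵐ x ∂κ ω, x ∈ B → siteMass (κ ω) (η ω) r x ≤ centerMass (η ω) (κ ω) r x := by
  have hI : Measurable (B.indicator (1 : Space d → ℝ≥0∞)) := measurable_one.indicator hB
  set a : Ω × Space d → ℝ≥0∞ := fun p => B.indicator 1 p.2 * siteMass (κ p.1) (η p.1) r p.2 with ha
  set b : Ω × Space d → ℝ≥0∞ :=
    fun p => B.indicator 1 p.2 * centerMass (η p.1) (κ p.1) r p.2 with hb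
  have ham : Measurable a := (hI.comp measurable_snd).mul (measurable_siteMass r)
  have hbm : Measurable b := (hI.comp measurable_snd).mul (measurable_centerMass r)
  have hba : b ≤ a := fun p => mul_le_mul_right (centerMass_swap_le_siteMass _ _ _ _) _
  have hle : ∫⁻ p, a p ∂(P ⊗ₘ κ) ≤ ∫⁻ p, b p ∂(P ⊗ₘ κ) := by
    rw [Measure.lintegral_compProd ham, Measure.lintegral_compProd hbm]
    calc ∫⁻ ω, ∫⁻ x, B.indicator 1 x * siteMass (κ ω) (η ω) r x ∂κ ω ∂P
        = ∫⁻ ω, ∫⁻ ξ, B.indicator 1 ξ * centerMass (κ ω) (η ω) r ξ ∂η ω ∂P :=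
          lintegral_siteMass_eq hθ hP hκ hη hκf hηf hB hB0 hBt r
      _ ≤ ∫⁻ ω, ∫⁻ ξ, B.indicator 1 ξ * siteMass (η ω) (κ ω) r ξ ∂η ω ∂P :=
          lintegral_mono fun ω => lintegral_mono fun ξ =>
            mul_le_mul_right (centerMass_swap_le_siteMass _ _ _ _) _
      _ = ∫⁻ ω, ∫⁻ x, B.indicator 1 x * centerMass (η ω) (κ ω) r x ∂κ ω ∂P :=
          lintegral_siteMass_eq hθ hP hη hκ hηf hκf hB hB0 hBt r
  have hfin : ∫⁻ p, b p ∂(P ⊗ₘ κ) ≠ ∞ := by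
    refine ne_top_of_le_ne_top hint ?_
    rw [Measure.lintegral_compProd hbm]
    refine lintegral_mono fun ω => ?_
    rw [← lintegral_indicator_one hB]
    exact lintegral_mono fun x => mul_le_of_le_one_right' (min_le_left _ _)
  have hae := Measure.ae_ae_of_ae_compProd
    (ae_eq_of_ae_le_of_lintegral_le (.of_forall hba) hfin ham.aemeasurable hle)
  filter_upwards [hae] with ω hω
  filter_upwards [hω] with x hx hxB
  simp only [ha, hb, indicator_of_mem hxB, Pi.one_apply, one_mul] at hx
  exact hx.ge

/-- Almost surely, the site-proposing procedure does not transport more mass than the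
center-proposing one. -/
theorem ae_siteMass_le_centerMass [SFinite P] [IsSFiniteKernel κ] [IsSFiniteKernel η]
    (hθ : IsMeasurableFlow θ) (hP : IsStationaryProb θ P)
    (hκ : ∀ s ω, κ (θ s ω) = shift s (κ ω)) (hη : ∀ s ω, η (θ s ω) = shift s (η ω))
    (hκf : ∀ ω, IsLocallyFiniteMeasure (κ ω)) (hηf : ∀ ω, IsLocallyFiniteMeasure (η ω))
    {c : ℝ≥0∞} (hc : HasIntensity P κ c) (hct : c < ∞) :
    ∀ᵐ ω ∂P, ∀ᵐ x ∂κ ω, ∀ r, siteMass (κ ω) (η ω) r x ≤ centerMass (η ω) (κ ω) r x := by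
  -- Countably many balls and rational radii keep the exceptional set null; right continuity of
  -- closed-ball masses then yields all real radii.
  have hae : ∀ᵐ ω ∂P, ∀ (n : ℕ) (q : ℚ), ∀ᵐ x ∂κ ω, x ∈ ball (0 : Space d) (n + 1) →
      siteMass (κ ω) (η ω) q x ≤ centerMass (η ω) (κ ω) q x := by
    refine ae_all_iff.2 fun n => ae_all_iff.2 fun q => ?_
    have hvol : volume (ball (0 : Space d) (n + 1)) < ∞ := measure_ball_lt_top
    refine ae_siteMass_le_centerMass_of_measurableSet hθ hP hκ hη hκf hηf measurableSet_ball
      (measure_ball_pos _ _ (by positivity)).ne' hvol.ne ?_ q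
    rw [hc _ measurableSet_ball]
    exact ENNReal.mul_ne_top hct.ne hvol.ne
  filter_upwards [hae] with ω hω
  have := hηf ω
  filter_upwards [ae_all_iff.2 fun n => ae_all_iff.2 (hω n)] with x hx r
  refine le_min (min_le_left _ _) ?_
  rw [← withDensity_apply _ measurableSet_closedBall]
  refine le_measure_closedBall_of_forall_gt
    (withDensity_closedBall_lt_top (fun ξ => centerAvail_le_one _ _ _ _) x) fun ρ hρ => ?_
  obtain ⟨q, hrq, hqρ⟩ := exists_rat_btwn hρ
  obtain ⟨n, hn⟩ := exists_nat_gt (dist x 0)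
  have hxn : x ∈ ball (0 : Space d) (n + 1) := mem_ball.2 (hn.trans (lt_add_one _))
  rw [withDensity_apply _ measurableSet_closedBall]
  calc siteMass (κ ω) (η ω) r x ≤ siteMass (κ ω) (η ω) q x :=
        min_le_min_left _ (lintegral_mono_set (closedBall_subset_closedBall hrq.le))
    _ ≤ centerMass (η ω) (κ ω) q x := hx n q hxn
    _ ≤ ∫⁻ ξ in closedBall x q, centerAvail (η ω) (κ ω) ξ x ∂η ω := min_le_right _ _
    _ ≤ _ := lintegral_mono_set (closedBall_subset_closedBall hqρ.le)

end Uniqueness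

end StableTransport

open StableTransport in
theorem theorem3p18 {d : ℕ} {Ω : Type*} [MeasurableSpace Ω]
    (θ : Space d → Ω → Ω) (hθ : IsMeasurableFlow θ)
    (P : Measure Ω) [IsProbabilityMeasure P]
    (Φ Ψ : Ω → Measure (Space d))
    (hΦ : IsStationaryRandomMeasure θ P Φ) (hΨ : IsStationaryRandomMeasure θ P Ψ)
    (lamΦ lamΨ : ℝ≥0∞)
    (hlamΦ : HasIntensity P Φ lamΦ) (hlamΨ : HasIntensity P Ψ lamΨ)
    (hΦpos : 0 < lamΦ) (hΦfin : lamΦ < ∞) (hΨpos : 0 < lamΨ) (hΨfin : lamΨ < ∞)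
    (hA : ∀ᵐ ω ∂P, UniquenessAssumption (Φ ω) (Ψ ω)) :
    ∀ᵐ ω ∂P, ∀ f g : Space d → Space d → ℝ≥0,
      IsStableConstrained (Φ ω) (Ψ ω) f → IsStableConstrained (Φ ω) (Ψ ω) g →
      ∀ᵐ p ∂((Φ ω).prod (Ψ ω)), f p.1 p.2 = g p.1 p.2 := by
  let κ : ProbabilityTheory.Kernel Ω (Space d) := ⟨Φ, hΦ.measurable⟩
  let η : ProbabilityTheory.Kernel Ω (Space d) := ⟨Ψ, hΨ.measurable⟩
  have : ProbabilityTheory.IsSFiniteKernel κ :=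
    isSFiniteKernel_of_isLocallyFinite κ hΦ.locallyFinite
  have : ProbabilityTheory.IsSFiniteKernel η :=
    isSFiniteKernel_of_isLocallyFinite η hΨ.locallyFinite
  have hsite := ae_siteMass_le_centerMass (κ := κ) (η := η) hθ hΦ.stationary hΦ.flowAdapted
    hΨ.flowAdapted hΦ.locallyFinite hΨ.locallyFinite hlamΦ hΦfin
  -- The same result with sites and centers exchanged provides the bound around the centers.
  have hcenter := ae_siteMass_le_centerMass (κ := η) (η := κ) hθ hΦ.stationary hΨ.flowAdapted
    hΦ.flowAdapted hΨ.locallyFinite hΦ.locallyFinite hlamΨ hΨfin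
  filter_upwards [hA, hsite, hcenter] with ω h1 h2 h3 f g hf hg
  have := hΦ.locallyFinite ω
  have := hΨ.locallyFinite ω
  exact hf.ae_eq hg h1 h2 h3
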